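/- For $p>0$ and $m\in(0,1)\cup(1,\infty)$ let $$g_1(p,m)=\cos\tfrac pm\,\sin p-m\cos p\,\sin\tfrac pm,\qquad g_2(p,m)=m\,p\cos\tfrac pm\,\sin p-\bigl(p\cos p+(m^2-1)\sin p\bigr)\sin\tfrac pm .$$ For every such $m$ the functions $g_1(\cdot,m)$ and $g_2(\cdot,m)$ have minimal positive roots $p_1(m)=\min\{p>0: g_1(p,m)=0\}$ and $p_2(m)=\min\{p>0: g_2(p,m)=0\}$. Say that two graphs cross at $a$ if the functions agree at $a$ and one of them is strictly smaller than the other at all points close to $a$ on one side of $a$ and strictly larger at all points close to $a$ on the other side. Then: (a) $p_1$ and $p_2$ are continuous on $(0,1)\cup(1,\infty)$. (b) $p_1(m)<p_2(m)$ for $m\in(0,\frac12)\cup(2,\infty)$. (c) For every integer $k\ge1$: $p_1(m)>p_2(m)$ for $m\in\left(\frac{k}{1+k},\ \frac{1+2k}{3+2k}-\frac{2}{15+40k+32k^2+8k^3}\right]$; $p_1(m)<p_2(m)$ for $m\in\left[\frac{1+2k}{3+2k},\ \frac{1+k}{2+k}\right)$; the graphs of $p_1$ and $p_2$ cross at $m=\frac{k}{k+1}$,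 where $p_1(m)=p_2(m)=\frac{\pi m}{1-m}=\pi k$, and at some point $\bar m_k\in\left(\frac{1+2k}{3+2k}-\frac{2}{15+40k+32k^2+8k^3},\ \frac{1+2k}{3+2k}\right)$. Likewise, for every integer $k\ge1$: $p_1(m)<p_2(m)$ for $m\in\left(\frac{k+2}{k+1},\ \frac{3+2k}{1+2k}\right]$; $p_1(m)>p_2(m)$ for $m\in\left[\frac{3+2k}{1+2k}+\frac{2}{1+8k(1+k^2)},\ \frac{k+1}{k}\right)$; the graphs of $p_1$ and $p_2$ cross at $m=\frac{k+1}{k}$, where $p_1(m)=p_2(m)=\pi(k+1)$, and at some point $\bar m_k'\in\left(\frac{3+2k}{1+2k},\ \frac{3+2k}{1+2k}+\frac{2}{1+8k(1+k^2)}\right)$. (d) $p_1(m)\to+\infty$ and $p_2(m)\to+\infty$ as $m\to1$. (e) For every integer $k\ge1$ the graphs cross at an acute angle at $\frac{k}{k+1}$ and at $\frac{k+1}{k}$: $p_1$ has there an infinite derivative (as the limit of its difference quotients) and $p_2$ is differentiable there, with $$0<p_2'\bigl(\tfrac{k}{k+1}\bigr)<p_1'\bigl(\tfrac{k}{k+1}\bigr)=+\infty,\qquad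 -\infty=p_1'\bigl(\tfrac{k+1}{k}\bigr)<p_2'\bigl(\tfrac{k+1}{k}\bigr)<0 .$$ -/

import Mathlib

open Filter Topology Set

namespace PlateBall

/-- The function `g₁(p, m) = cos (p/m) sin p - m cos p sin (p/m)`. -/
noncomputable def g₁ (p m : ℝ) : ℝ :=
  Real.cos (p / m) * Real.sin p - m * Real.cos p * Real.sin (p / m)

/-- The function
`g₂(p, m) = m p cos (p/m) sin p - (p cos p + (m² - 1) sin p) sin (p/m)`. -/
noncomputable def g₂ (p m : ℝ) : ℝ :=
  m * p * Real.cos (p / m) * Real.sin p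
    - (p * Real.cos p + (m ^ 2 - 1) * Real.sin p) * Real.sin (p / m)

/-- The first positive root of `g₁(·, m)`, taken as an infimum; that the infimum is attained
(so that it is the minimal positive root) for `m > 0`, `m ≠ 1` is a claim of the theorem. -/
noncomputable def p₁ (m : ℝ) : ℝ := sInf {p : ℝ | 0 < p ∧ g₁ p m = 0}

/-- The first positive root of `g₂(·, m)`, taken as an infimum; that the infimum is attained
(so that it is the minimal positive root) for `m > 0`, `m ≠ 1` is a claim of the theorem. -/
noncomputable def p₂ (m : ℝ) : ℝ := sInf {p : ℝ | 0 < p ∧ g₂ p m = 0}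

/-- The graphs of `f` and `g` cross at `a`: the values at `a` agree, and one graph passes from
strictly below the other one to strictly above it. -/
def GraphsCrossAt (f g : ℝ → ℝ) (a : ℝ) : Prop :=
  f a = g a ∧
    (((∀ᶠ m in 𝓝[<] a, f m < g m) ∧ (∀ᶠ m in 𝓝[>] a, g m < f m)) ∨
      ((∀ᶠ m in 𝓝[<] a, g m < f m) ∧ (∀ᶠ m in 𝓝[>] a, f m < g m)))

/-- `f' a = +∞`: the difference quotients of `f` at `a` tend to `+∞`. -/
def HasDerivPosInfAt (f : ℝ → ℝ) (a : ℝ) : Prop :=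
  Tendsto (fun m => (f m - f a) / (m - a)) (𝓝[≠] a) atTop

/-- `f' a = -∞`: the difference quotients of `f` at `a` tend to `-∞`. -/
def HasDerivNegInfAt (f : ℝ → ℝ) (a : ℝ) : Prop :=
  Tendsto (fun m => (f m - f a) / (m - a)) (𝓝[≠] a) atBot

end PlateBall

/-! The substitution p = m q turns g₁(·, m) and g₂(·, m) into negative multiples of g₁(·, 1/m) and
g₂(·, 1/m). Hence pᵢ(m) = m pᵢ(1/m) for m > 1, and everything reduces to m < 1.

For m < 1 both G = g₁ and G = g₂/p satisfy G' = -w S(p) S(p/m) with w > 0, where S = sin,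
respectively S(x) = sin x - x cos x. With z_j the zeros of S, the critical points of G are the z_j
and the m z_j. While they interlace, z_i < m z_{i+1} < z_{i+1}, the peaks of G are the points
z_{i+1}, and a product formula shows G < 0 there. As soon as m z_{k+2} ≤ z_{k+1}, the climb from m
z_{k+1} ends at m z_{k+2} with G ≥ 0. So the first zero lies in (m z_{k+1}, m z_{k+2}] when
z_k/z_{k+1} < m ≤ z_{k+1}/z_{k+2} (`exists_first_zero`).

Let t_k be the solutions of tan x = x. For k ≥ 1 the windows are ordered by k/(k+1) < t_k/t_{k+1} <
(2k+1)/(2k+3) < (k+1)/(k+2). Evaluating the identity p g₁ = m (g₂ - (1 - m²) sin p · S(p/m)), with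
S(x) = sin x - x cos x, at p₁ or p₂ decides their order, because the windows fix the signs of the
factors (`p₂_lt_p₁`, `p₁_lt_p₂`). The order switches at m = k/(k+1), where p = kπ annihilates both
sines, and at m = t_k/t_{k+1}, where p and p/m are consecutive solutions of tan x = x. The explicit
interval around the second crossing comes from the estimate `lt_tanRoot_ratio`.

Continuity follows from the sign change of G at its first zero, and divergence at 1 from pᵢ(m) > m
(n+1) π for m close to 1. The slopes at k/(k+1) come from linearizing g(P(m), m) = 0: there ∂g₁/∂p =
0 while ∂g₂/∂p ≠ 0. -/

namespace PlateBall

/-! ### First zero of an oscillating function -/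

/-- A function `G` of product type `S(p) T(p/m) - S(p/m) T(p)`, where `S` has the zeros
`0 = z 0 < z 1 < ⋯` with alternating signs in between, whose derivative is a negative multiple of
`S(p) S(p/m)`. -/
structure Oscillation (m : ℝ) (z : ℕ → ℝ) (S T G : ℝ → ℝ) : Prop where
  m_pos : 0 < m
  m_lt : m < 1
  z_zero : z 0 = 0
  z_mono : StrictMono z
  S_zero : ∀ j, S (z j) = 0
  S_sign : ∀ j, ∀ x ∈ Ioo (z j) (z (j + 1)), 0 < (-1) ^ j * S x
  T_sign : ∀ j, 1 ≤ j → 0 < (-1) ^ j * T (z j)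
  lim : Tendsto G (𝓝[>] 0) (𝓝 0)
  deriv : ∀ p, 0 < p → ∃ w, 0 < w ∧ HasDerivAt G (-(w * (S p * S (p / m)))) p
  eq : ∀ p, 0 < p → ∃ a b, 0 < a ∧ 0 < b ∧ G p = a * (S p * T (p / m)) - b * (S (p / m) * T p)

namespace Oscillation

variable {m : ℝ} {z : ℕ → ℝ} {S T G : ℝ → ℝ}

lemma z_pos (h : Oscillation m z S T G) {j : ℕ} (hj : 1 ≤ j) : 0 < z j := by
  rw [← h.z_zero]; exact h.z_mono (by omega)

lemma continuousOn (h : Oscillation m z S T G) : ContinuousOn G (Ioi 0) := fun p hp => by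
  obtain ⟨w, -, hw⟩ := h.deriv p hp
  exact hw.continuousAt.continuousWithinAt

lemma sign_mul_self (j : ℕ) : ((-1 : ℝ) ^ j) * (-1) ^ j = 1 := by
  rw [← mul_pow]; simp

lemma mul_pos_of_sign {j : ℕ} {x y : ℝ} (hx : 0 < (-1) ^ j * x) (hy : 0 < (-1) ^ j * y) :
    0 < x * y := by
  have := mul_pos hx hy
  have e : (-1) ^ j * x * ((-1) ^ j * y) = ((-1 : ℝ) ^ j * (-1) ^ j) * (x * y) := by ring
  rwa [e, sign_mul_self, one_mul] at this

lemma mul_neg_of_sign {j : ℕ} {x y : ℝ} (hx : 0 < (-1) ^ j * x) (hy : 0 < (-1) ^ (j + 1) * y) :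
    x * y < 0 := by
  have : 0 < x * (-y) := mul_pos_of_sign hx (by rw [pow_succ] at hy; linarith)
  linarith

lemma strictAntiOn (h : Oscillation m z S T G) {a b : ℝ} (ha : 0 < a)
    (hS : ∀ p ∈ Ioo a b, 0 < S p * S (p / m)) : StrictAntiOn G (Icc a b) := by
  apply strictAntiOn_of_deriv_neg (convex_Icc a b)
    (h.continuousOn.mono fun x hx => ha.trans_le hx.1)
  intro p hp
  rw [interior_Icc] at hp
  obtain ⟨w, hw, hd⟩ := h.deriv p (ha.trans hp.1)
  rw [hd.deriv]
  have := mul_pos hw (hS p hp)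
  linarith

lemma strictMonoOn (h : Oscillation m z S T G) {a b : ℝ} (ha : 0 < a)
    (hS : ∀ p ∈ Ioo a b, S p * S (p / m) < 0) : StrictMonoOn G (Icc a b) := by
  apply strictMonoOn_of_deriv_pos (convex_Icc a b)
    (h.continuousOn.mono fun x hx => ha.trans_le hx.1)
  intro p hp
  rw [interior_Icc] at hp
  obtain ⟨w, hw, hd⟩ := h.deriv p (ha.trans hp.1)
  rw [hd.deriv]
  have := mul_neg_of_pos_of_neg hw (hS p hp)
  linarith

lemma mul_pos_same (h : Oscillation m z S T G) {j : ℕ} {p : ℝ} (h1 : z j < p)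
    (h2 : p < m * z (j + 1)) : 0 < S p * S (p / m) := by
  have hm := h.m_pos
  have hp : 0 < p := lt_of_le_of_lt (by rw [← h.z_zero]; exact h.z_mono.monotone (by omega)) h1
  have hq : p < p / m := by rw [lt_div_iff₀ hm]; nlinarith [h.m_lt]
  have hq2 : p / m < z (j + 1) := by rwa [div_lt_iff₀ hm, mul_comm]
  exact mul_pos_of_sign (h.S_sign j p ⟨h1, hq.trans hq2⟩) (h.S_sign j _ ⟨h1.trans hq, hq2⟩)

lemma mul_neg_succ (h : Oscillation m z S T G) {j : ℕ} {p : ℝ} (h1 : z j < p)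
    (h2 : p < z (j + 1)) (h3 : m * z (j + 1) < p) (h4 : p < m * z (j + 2)) :
    S p * S (p / m) < 0 := by
  have hm := h.m_pos
  refine mul_neg_of_sign (h.S_sign j p ⟨h1, h2⟩) (h.S_sign (j + 1) _ ⟨?_, ?_⟩)
  · rwa [lt_div_iff₀ hm, mul_comm]
  · rwa [div_lt_iff₀ hm, mul_comm]

/-- Under the interlacing hypothesis the critical points are ordered 0 < m z₁ < z₁ < m z₂ < ⋯, and
`G` falls up to each m zᵢ and climbs from there to zᵢ. It therefore suffices to know that the peaks
zᵢ lie below zero. -/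
lemma neg_of_le (h : Oscillation m z S T G) {j : ℕ} (hz : ∀ i < j + 1, z i < m * z (i + 1)) :
    ∀ p, 0 < p → p ≤ m * z (j + 1) → G p < 0 := by
  have hm := h.m_pos
  induction j with
  | zero =>
    intro p hp0 hp
    have hanti : ∀ x, 0 < x → StrictAntiOn G (Icc x (m * z 1)) := fun x hx =>
      h.strictAntiOn hx fun y hy => h.mul_pos_same (j := 0) (by rw [h.z_zero]; linarith [hy.1]) hy.2
    -- Only a one-sided limit at 0 is available, so strictness is gained by passing through p/2.
    have h1 : G p < G (p / 2) :=
      hanti (p / 2) (by positivity) ⟨le_rfl, by simp at hp; linarith⟩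
        ⟨by linarith, by simpa using hp⟩ (by linarith)
    have h2 : G (p / 2) ≤ 0 := by
      refine ge_of_tendsto h.lim ?_
      filter_upwards [Ioo_mem_nhdsGT (show (0 : ℝ) < p / 2 by positivity)] with x hx
      exact (hanti x hx.1 ⟨le_rfl, by simp at hp; linarith [hx.2]⟩
        ⟨hx.2.le, by simp at hp; linarith⟩ hx.2).le
    linarith
  | succ j ih =>
    intro p hp0 hp
    have ih := ih fun i hi => hz i (by omega)
    rcases le_or_gt p (m * z (j + 1)) with h1 | h1
    · exact ih p hp0 h1
    have hzp : 0 < z (j + 1) := h.z_pos (by omega)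
    have hlast := hz (j + 1) (by omega)
    have hprev := hz j (by omega)
    have hmz : m * z (j + 1) < z (j + 1) := by nlinarith [h.m_lt]
    -- At a peak the first product vanishes. In the second one both factors carry the sign
    -- (-1)^(j+1), since z (j+1) / m lies between z (j+1) and z (j+2).
    have hG : G (z (j + 1)) < 0 := by
      obtain ⟨a, b, ha, hb, e⟩ := h.eq _ hzp
      rw [e, h.S_zero, zero_mul, mul_zero, zero_sub, neg_lt_zero]
      refine mul_pos hb (mul_pos_of_sign (h.S_sign (j + 1) _ ⟨?_, ?_⟩) (h.T_sign _ (by omega)))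
      · rw [lt_div_iff₀ hm]; nlinarith [h.m_lt]
      · rwa [div_lt_iff₀ hm, mul_comm]
    rcases le_total p (z (j + 1)) with h2 | h2
    · refine lt_of_le_of_lt ?_ hG
      exact (h.strictMonoOn (mul_pos hm hzp) fun y hy => h.mul_neg_succ (j := j)
        (hprev.trans hy.1) hy.2 hy.1 (hy.2.trans hlast)).monotoneOn ⟨h1.le, h2⟩
        ⟨hmz.le, le_rfl⟩ h2
    · refine lt_of_le_of_lt ?_ hG
      exact (h.strictAntiOn hzp fun y hy => h.mul_pos_same (j := j + 1)
        hy.1 hy.2).antitoneOn ⟨le_rfl, hlast.le⟩ ⟨h2, hp⟩ h2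

/-- The location of the first zero and the signs around it. -/
lemma exists_first_zero (h : Oscillation m z S T G) {j : ℕ}
    (hz : ∀ i < j + 1, z i < m * z (i + 1)) (hj : m * z (j + 2) ≤ z (j + 1)) :
    ∃ P, m * z (j + 1) < P ∧ P ≤ m * z (j + 2) ∧ G P = 0 ∧ (∀ p, 0 < p → p < P → G p < 0) ∧
      (∀ p, P < p → p ≤ m * z (j + 2) → 0 < G p) ∧ ∃ e > P, ∀ p ∈ Ioo P e, 0 < G p := by
  have hm := h.m_pos
  have hzp : 0 < z (j + 1) := h.z_pos (by omega)
  have hzp2 : z (j + 1) < z (j + 2) := h.z_mono (by omega)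
  have hzp3 : z (j + 2) < z (j + 3) := h.z_mono (by omega)
  have hneg := h.neg_of_le hz
  have hprev := hz j (by omega)
  have hA : m * z (j + 1) < m * z (j + 2) := by gcongr
  have hmono : StrictMonoOn G (Icc (m * z (j + 1)) (m * z (j + 2))) :=
    h.strictMonoOn (mul_pos hm hzp) fun y hy => h.mul_neg_succ (j := j)
      (hprev.trans hy.1) (hy.2.trans_le hj) hy.1 hy.2
  have hpos : 0 < m * z (j + 2) := mul_pos hm (hzp.trans hzp2)
  have hend : m * z (j + 2) < z (j + 1) → 0 < G (m * z (j + 2)) := fun hlt => by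
    obtain ⟨a, b, ha, hb, e⟩ := h.eq _ hpos
    have e1 : m * z (j + 2) / m = z (j + 2) := by field_simp
    rw [e, e1, h.S_zero, zero_mul, mul_zero, sub_zero]
    refine mul_pos ha (mul_pos_of_sign (h.S_sign j _ ⟨by linarith, hlt⟩) ?_)
    have := h.T_sign (j + 2) (by omega)
    rwa [pow_add, neg_one_sq, mul_one] at this
  have hend0 : m * z (j + 2) = z (j + 1) → G (m * z (j + 2)) = 0 := fun heq => by
    obtain ⟨a, b, ha, hb, e⟩ := h.eq _ hpos
    have e1 : m * z (j + 2) / m = z (j + 2) := by field_simp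
    rw [e, e1, heq, h.S_zero, h.S_zero]; simp
  have hend' : 0 ≤ G (m * z (j + 2)) := by
    rcases hj.lt_or_eq with h1 | h1
    · exact (hend h1).le
    · exact (hend0 h1).ge
  obtain ⟨P, hP, hP0⟩ := intermediate_value_Icc hA.le
    (h.continuousOn.mono fun x hx => (mul_pos hm hzp).trans_le hx.1)
    ⟨(hneg _ (mul_pos hm hzp) le_rfl).le, hend'⟩
  have hP1 : m * z (j + 1) < P := by
    refine lt_of_le_of_ne hP.1 fun e => ?_
    have := hneg _ (mul_pos hm hzp) le_rfl
    rw [e, hP0] at this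
    exact lt_irrefl _ this
  have hafter : ∀ p, P < p → p ≤ m * z (j + 2) → 0 < G p := fun p h1 h2 => by
    rw [← hP0]; exact hmono hP ⟨hP.1.trans h1.le, h2⟩ h1
  refine ⟨P, hP1, hP.2, hP0, fun p hp0 hp => ?_, hafter, ?_⟩
  · rcases le_or_gt p (m * z (j + 1)) with h1 | h1
    · exact hneg p hp0 h1
    · rw [← hP0]; exact hmono ⟨h1.le, hp.le.trans hP.2⟩ hP hp
  · rcases hP.2.lt_or_eq with h1 | h1
    · exact ⟨_, h1, fun p hp => hafter p hp.1 hp.2.le⟩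
    -- Here the zero sits at the end of the climb, which forces the two kinds of critical points to
    -- coincide. Both factors of G' then change sign at once, so `G` keeps increasing.
    have h2 : m * z (j + 2) = z (j + 1) := by
      refine hj.lt_or_eq.resolve_left fun h3 => ?_
      have := hend h3
      rw [← h1, hP0] at this
      exact lt_irrefl _ this
    have h3 : z (j + 1) = P := by rw [h1, h2]
    have hlt : P < min (z (j + 2)) (m * z (j + 3)) := by
      rw [lt_min_iff]
      constructor
      · rw [← h3]; exact hzp2
      · rw [h1]; gcongr
    refine ⟨_, hlt, fun p hp => ?_⟩
    rw [← hP0]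
    refine h.strictMonoOn (b := min (z (j + 2)) (m * z (j + 3))) (by linarith) (fun y hy => ?_)
      ⟨le_rfl, hlt.le⟩ ⟨hp.1.le, hp.2.le⟩ hp.1
    have := lt_min_iff.1 hy.2
    exact h.mul_neg_succ (j := j + 1) (by linarith [hy.1]) this.1 (by linarith [hy.1]) this.2

end Oscillation

/-! ### Solutions of tan x = x -/

/-- The function `sin x - x cos x`, whose zeros are the solutions of `tan x = x`. -/
noncomputable def tanFun (x : ℝ) : ℝ := Real.sin x - x * Real.cos x

lemma hasDerivAt_tanFun (x : ℝ) : HasDerivAt tanFun (x * Real.sin x) x := by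
  have : HasDerivAt tanFun (Real.cos x - (1 * Real.cos x + x * -Real.sin x)) x :=
    (Real.hasDerivAt_sin x).sub ((hasDerivAt_id x).mul (Real.hasDerivAt_cos x))
  exact this.congr_deriv (by ring)

lemma continuous_tanFun : Continuous tanFun :=
  continuous_iff_continuousAt.2 fun x => (hasDerivAt_tanFun x).continuousAt

lemma sin_sign {j : ℕ} {x : ℝ} (h1 : j * Real.pi < x) (h2 : x < (j + 1) * Real.pi) :
    0 < (-1) ^ j * Real.sin x := by
  rw [← Real.sin_sub_nat_mul_pi]
  exact Real.sin_pos_of_pos_of_lt_pi (by linarith) (by linarith)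

lemma strictMonoOn_sign_mul_tanFun (j : ℕ) :
    StrictMonoOn (fun x => (-1) ^ j * tanFun x) (Icc (j * Real.pi) ((j + 1) * Real.pi)) := by
  apply strictMonoOn_of_deriv_pos (convex_Icc _ _)
    (continuous_tanFun.const_mul ((-1) ^ j)).continuousOn
  intro x hx
  rw [interior_Icc] at hx
  rw [((hasDerivAt_tanFun x).const_mul _).deriv]
  have h1 := sin_sign hx.1 hx.2
  have h2 : 0 < x := lt_of_le_of_lt (by positivity) hx.1
  have := mul_pos h2 h1
  linarith

lemma exists_tanRoot (j : ℕ) : ∃ x, j * Real.pi ≤ x ∧ x < (j + 1 / 2) * Real.pi ∧ tanFun x = 0 := by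
  have hpi := Real.pi_pos
  have hs : ∀ y, ((-1 : ℝ) ^ j) * ((-1) ^ j * y) = y := fun y => by
    rw [← mul_assoc, Oscillation.sign_mul_self, one_mul]
  have e1 : (-1) ^ j * tanFun (j * Real.pi) = -(j * Real.pi) := by
    have := hs 1
    simp only [mul_one] at this
    rw [tanFun, Real.sin_nat_mul_pi, Real.cos_nat_mul_pi]
    linear_combination (-(j * Real.pi)) * this
  have e2 : (-1) ^ j * tanFun ((j + 1 / 2) * Real.pi) = 1 := by
    have a : ((j : ℝ) + 1 / 2) * Real.pi = Real.pi / 2 + j * Real.pi := by ring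
    rw [tanFun, a, Real.sin_add_nat_mul_pi, Real.cos_add_nat_mul_pi]
    simpa using hs 1
  obtain ⟨x, hx, hx0⟩ := intermediate_value_Icc
    (show (j : ℝ) * Real.pi ≤ (j + 1 / 2) * Real.pi by nlinarith)
    (continuous_tanFun.const_mul ((-1) ^ j)).continuousOn
    (show (0 : ℝ) ∈ _ from ⟨by rw [e1]; simp; positivity, by rw [e2]; norm_num⟩)
  refine ⟨x, hx.1, lt_of_le_of_ne hx.2 fun e => ?_, ?_⟩
  · simp only [e, e2] at hx0; norm_num at hx0
  · have := hs (tanFun x)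
    simp only at hx0
    rw [hx0, mul_zero] at this
    exact this.symm

/-- The `j`-th nonnegative solution of `tan x = x`. -/
noncomputable def tanRoot (j : ℕ) : ℝ := (exists_tanRoot j).choose

lemma le_tanRoot (j : ℕ) : j * Real.pi ≤ tanRoot j := (exists_tanRoot j).choose_spec.1

lemma tanRoot_lt (j : ℕ) : tanRoot j < (j + 1 / 2) * Real.pi := (exists_tanRoot j).choose_spec.2.1

lemma tanFun_tanRoot (j : ℕ) : tanFun (tanRoot j) = 0 := (exists_tanRoot j).choose_spec.2.2

lemma tanRoot_lt_succ_mul_pi (j : ℕ) : tanRoot j < (j + 1) * Real.pi :=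
  (tanRoot_lt j).trans (by nlinarith [Real.pi_pos])

lemma tanRoot_mem (j : ℕ) : tanRoot j ∈ Icc (j * Real.pi) ((j + 1) * Real.pi) :=
  ⟨le_tanRoot j, (tanRoot_lt_succ_mul_pi j).le⟩

lemma strictMono_tanRoot : StrictMono tanRoot := strictMono_nat_of_lt_succ fun j => by
  have := le_tanRoot (j + 1)
  push_cast at this
  exact (tanRoot_lt_succ_mul_pi j).trans_le this

lemma tanFun_sign_left {j : ℕ} {x : ℝ} (h1 : j * Real.pi ≤ x) (h2 : x < tanRoot j) :
    (-1) ^ j * tanFun x < 0 := by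
  have := strictMonoOn_sign_mul_tanFun j ⟨h1, h2.le.trans (tanRoot_mem j).2⟩ (tanRoot_mem j) h2
  simpa [tanFun_tanRoot] using this

lemma tanFun_sign {j : ℕ} {x : ℝ} (h1 : tanRoot j < x) (h2 : x < tanRoot (j + 1)) :
    0 < (-1) ^ j * tanFun x := by
  rcases le_or_gt x ((j + 1) * Real.pi) with h3 | h3
  · have := strictMonoOn_sign_mul_tanFun j (tanRoot_mem j) ⟨(le_tanRoot j).trans h1.le, h3⟩ h1
    simpa [tanFun_tanRoot] using this
  · have := tanFun_sign_left (j := j + 1) (by push_cast; exact h3.le) h2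
    rw [pow_succ] at this
    linarith

lemma tanRoot_zero : tanRoot 0 = 0 := by
  by_contra h
  have h1 : 0 ≤ tanRoot 0 := by simpa using le_tanRoot 0
  have := tanFun_sign_left (j := 0) (x := 0) (by simp) (lt_of_le_of_ne h1 (Ne.symm h))
  simp [tanFun] at this

lemma tanRoot_pos {j : ℕ} (hj : 1 ≤ j) : 0 < tanRoot j := by
  rw [← tanRoot_zero]; exact strictMono_tanRoot (by omega)

lemma lt_tanRoot {j : ℕ} (hj : 1 ≤ j) : j * Real.pi < tanRoot j := by
  refine lt_of_le_of_ne (le_tanRoot j) fun e => ?_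
  have h := tanFun_tanRoot j
  rw [← e, tanFun, Real.sin_nat_mul_pi, Real.cos_nat_mul_pi] at h
  have : (0 : ℝ) < j := by exact_mod_cast hj
  have h2 : (j * Real.pi) * (-1) ^ j ≠ 0 := by have := Real.pi_pos; positivity
  exact h2 (by linarith)

/-! ### Bounds for the ratios of consecutive solutions -/

/-- At a zero x of `tanFun` one has tanFun (x + π) = π cos x. Its sign shows that the shifted point
has not yet reached the next zero. -/
lemma tanRoot_add_pi_lt (j : ℕ) : tanRoot j + Real.pi < tanRoot (j + 1) := by
  have hpi := Real.pi_pos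
  by_contra! hle
  have h1 : (tanRoot j + Real.pi) ∈ Icc (((j + 1 : ℕ) : ℝ) * Real.pi) (((j + 1 : ℕ) + 1) * Real.pi) := by
    have := tanRoot_mem j
    push_cast
    exact ⟨by linarith [this.1], by linarith [this.2]⟩
  have h2 := (strictMonoOn_sign_mul_tanFun (j + 1)).monotoneOn (tanRoot_mem (j + 1)) h1 hle
  simp only [tanFun_tanRoot, mul_zero] at h2
  have h0 := tanFun_tanRoot j
  have h3 : tanFun (tanRoot j + Real.pi) = Real.pi * Real.cos (tanRoot j) := by
    unfold tanFun at h0 ⊢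
    rw [Real.sin_add_pi, Real.cos_add_pi]
    linarith
  have h4 : 0 < (-1) ^ j * Real.cos (tanRoot j) := by
    rw [← Real.cos_sub_nat_mul_pi]
    exact Real.cos_pos_of_mem_Ioo ⟨by linarith [le_tanRoot j], by linarith [tanRoot_lt j]⟩
  rw [h3, pow_succ] at h2
  nlinarith [mul_pos hpi h4]

lemma tanRoot_ratio_lt (k : ℕ) : (2 * k + 3) * tanRoot k < (2 * k + 1) * tanRoot (k + 1) := by
  rcases Nat.eq_zero_or_pos k with rfl | hk
  · simpa [tanRoot_zero] using tanRoot_pos le_rfl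
  · have h1 := tanRoot_add_pi_lt k
    have h2 := tanRoot_lt k
    have h3 : (0 : ℝ) < 2 * k + 1 := by positivity
    nlinarith

/-- The distance of a solution of `tan x = x` to the next pole of the tangent. -/
lemma tanRoot_gap {j : ℕ} (hj : 1 ≤ j) :
    ((j + 1 / 2) * Real.pi - tanRoot j) * tanRoot j < 1 ∧
    1 - ((j + 1 / 2) * Real.pi - tanRoot j) ^ 2 / 2 ≤
      ((j + 1 / 2) * Real.pi - tanRoot j) * tanRoot j := by
  set d := (j + 1 / 2) * Real.pi - tanRoot j with hd
  have hpi := Real.pi_pos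
  have hd0 : 0 < d := by linarith [tanRoot_lt j]
  have hd1 : d < Real.pi / 2 := by linarith [lt_tanRoot hj]
  have hx := tanRoot_pos hj
  have h0 := tanFun_tanRoot j
  have e : tanRoot j = (Real.pi / 2 - d) + j * Real.pi := by rw [hd]; ring
  -- The equation tan x = x becomes cot d = x. The two bounds then come from tan d > d, and from sin
  -- d < d together with cos d ≥ 1 - d²/2.
  have h1 : Real.cos d = tanRoot j * Real.sin d := by
    have h2 : (-1) ^ j * Real.cos d = tanRoot j * ((-1) ^ j * Real.sin d) := by
      have : Real.sin (tanRoot j) = tanRoot j * Real.cos (tanRoot j) := by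
        unfold tanFun at h0; linarith
      rw [← Real.sin_pi_div_two_sub d, ← Real.cos_pi_div_two_sub d,
        ← Real.sin_add_nat_mul_pi, ← Real.cos_add_nat_mul_pi, ← e]
      exact this
    have h3 : ((-1 : ℝ) ^ j) ≠ 0 := by positivity
    apply mul_left_cancel₀ h3
    rw [h2]; ring
  constructor
  · have h2 : d * Real.cos d < Real.sin d := by
      have := Real.lt_tan hd0 hd1
      rwa [Real.tan_eq_sin_div_cos, lt_div_iff₀
        (Real.cos_pos_of_mem_Ioo ⟨by linarith, hd1⟩)] at this
    have h3 : 0 < Real.sin d := Real.sin_pos_of_pos_of_lt_pi hd0 (by linarith)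
    rw [h1] at h2
    by_contra! h4
    nlinarith
  · have h2 := Real.one_sub_sq_div_two_le_cos (x := d)
    have h3 := Real.sin_lt hd0
    nlinarith

/-- The fractions are the bounds for π d and π e used in `lt_tanRoot_ratio`, with k = t + 1. After
clearing denominators the numerator is a polynomial in t with nonnegative coefficients. -/
lemma tanRoot_gap_rational_bound {t : ℝ} (ht : 0 ≤ t) :
    (4 * (t + 1) ^ 2 + 10 * (t + 1) + 5) * ((2 + 2 / (9.85 * (t + 1) ^ 2)) / (2 * t + 3))
      - (4 * (t + 1) ^ 2 + 6 * (t + 1) + 1) * (2 / (2 * t + 5)) < 9.85 := by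
  rw [← sub_pos]
  have : 9.85 - ((4 * (t + 1) ^ 2 + 10 * (t + 1) + 5) *
      ((2 + 2 / (9.85 * (t + 1) ^ 2)) / (2 * t + 3))
      - (4 * (t + 1) ^ 2 + 6 * (t + 1) + 1) * (2 / (2 * t + 5))) =
      (9.85 ^ 2 * (t + 1) ^ 2 * (2 * t + 3) * (2 * t + 5)
        - (4 * (t + 1) ^ 2 + 10 * (t + 1) + 5) * (2 * 9.85 * (t + 1) ^ 2 + 2) * (2 * t + 5)
        + (4 * (t + 1) ^ 2 + 6 * (t + 1) + 1) * 2 * 9.85 * (t + 1) ^ 2 * (2 * t + 3)) /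
      (9.85 * (t + 1) ^ 2 * (2 * t + 3) * (2 * t + 5)) := by
    field_simp
    ring
  rw [this]
  apply div_pos _ (by positivity)
  ring_nf
  positivity

/-- Write the two solutions as (k + 1/2)π - d and (k + 3/2)π - e. Since (4k²+10k+5)(k+1/2) -
(4k²+6k+1)(k+3/2) = 1, the claim says that (4k²+10k+5) d - (4k²+6k+1) e < π. After multiplication by
π, the gap estimates bound π d and π e by rational functions of k. -/
lemma lt_tanRoot_ratio {k : ℕ} (hk : 1 ≤ k) :
    (4 * k ^ 2 + 6 * k + 1) * tanRoot (k + 1) < (4 * k ^ 2 + 10 * k + 5) * tanRoot k := by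
  have hpi := Real.pi_gt_d4
  have hpi2 := Real.pi_lt_d2
  obtain ⟨u1, -⟩ := tanRoot_gap hk
  obtain ⟨v1, v2⟩ := tanRoot_gap (j := k + 1) (by omega)
  have u3 := lt_tanRoot hk
  have u4 := tanRoot_lt k
  have v3 := lt_tanRoot (j := k + 1) (by omega)
  have v4 := tanRoot_lt (k + 1)
  obtain ⟨i, rfl⟩ : ∃ i, k = i + 1 := ⟨k - 1, by omega⟩
  push_cast at *
  set x := tanRoot (i + 1) with hx
  set y := tanRoot (i + 1 + 1) with hy
  set t : ℝ := (i : ℝ) with ht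
  have ht0 : 0 ≤ t := by positivity
  set d := (t + 1 + 1 / 2) * Real.pi - x with hd
  set e := (t + 1 + 1 + 1 / 2) * Real.pi - y with he
  have hx' : x = (t + 1 + 1 / 2) * Real.pi - d := by rw [hd]; ring
  have hy' : y = (t + 1 + 1 + 1 / 2) * Real.pi - e := by rw [he]; ring
  have hd0 : 0 < d := by linarith
  have he0 : 0 < e := by linarith
  -- 9.85 serves as a rational lower bound for π², both in estimating d² and as the final threshold.
  have hsq : 9.85 < Real.pi ^ 2 := by nlinarith
  have hd1 : d * (t + 1) * Real.pi < 1 := by nlinarith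
  have hd2 : 9.85 * (d ^ 2 * (t + 1) ^ 2) < 1 := by
    have h1 : (d * (t + 1) * Real.pi) ^ 2 < 1 := by
      have : 0 ≤ d * (t + 1) * Real.pi := by positivity
      nlinarith
    have h2 : 0 < d ^ 2 * (t + 1) ^ 2 := by positivity
    nlinarith
  have hd3 : d * Real.pi < (2 + 2 / (9.85 * (t + 1) ^ 2)) / (2 * t + 3) := by
    rw [lt_div_iff₀ (by positivity)]
    have h1 : d ^ 2 < 1 / (9.85 * (t + 1) ^ 2) := by
      rw [lt_div_iff₀ (by positivity)]; linarith
    have h2 : d * Real.pi * (2 * t + 3) = 2 * (d * x) + 2 * d ^ 2 := by rw [hx']; ring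
    rw [h2]
    have h3 : 2 / (9.85 * (t + 1) ^ 2) = 2 * (1 / (9.85 * (t + 1) ^ 2)) := by ring
    rw [h3]
    linarith
  have he1 : 2 / (2 * t + 5) ≤ e * Real.pi := by
    rw [div_le_iff₀ (by positivity)]
    have h2 : e * Real.pi * (2 * t + 5) = 2 * (e * y) + 2 * e ^ 2 := by rw [hy']; ring
    rw [h2]
    nlinarith [sq_nonneg e]
  have key := tanRoot_gap_rational_bound ht0
  have h1 : (4 * (t + 1) ^ 2 + 10 * (t + 1) + 5) * (d * Real.pi)
      - (4 * (t + 1) ^ 2 + 6 * (t + 1) + 1) * (e * Real.pi) < 9.85 := by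
    refine lt_of_le_of_lt (sub_le_sub ?_ ?_) key <;> gcongr
  have h2 : (4 * (t + 1) ^ 2 + 10 * (t + 1) + 5) * d
      - (4 * (t + 1) ^ 2 + 6 * (t + 1) + 1) * e < Real.pi := by
    by_contra! h
    have h3 := mul_le_mul_of_nonneg_right h Real.pi_pos.le
    linarith
  rw [hx', hy']
  linarith

/-! ### Identities and derivatives of g₁ and g₂ -/

lemma g₂_eq {p m : ℝ} (hm : 0 < m) :
    g₂ p m = Real.sin (p / m) * tanFun p - m ^ 2 * (Real.sin p * tanFun (p / m)) := by
  unfold g₂ tanFun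
  field_simp
  ring

/-- The comparison identity. For p > 0 and 0 < m < 1, at a zero of g₂ the sign of g₁ is opposite to
that of sin p · tanFun (p/m), and at a zero of g₁ the sign of g₂ equals it. -/
lemma g₁_mul_eq {p m : ℝ} (hm : 0 < m) :
    p * g₁ p m = m * (g₂ p m - (1 - m ^ 2) * (Real.sin p * tanFun (p / m))) := by
  rw [g₂_eq hm]
  unfold g₁ tanFun
  field_simp
  ring

lemma hasDerivAt_g₁_left (p : ℝ) {m : ℝ} (hm : 0 < m) :
    HasDerivAt (fun p => g₁ p m) ((m - 1 / m) * (Real.sin p * Real.sin (p / m))) p := by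
  have h1 : HasDerivAt (fun p : ℝ => p / m) (1 / m) p := (hasDerivAt_id p).div_const m
  have h2 : HasDerivAt (fun p => g₁ p m) _ p :=
    (h1.cos.mul (Real.hasDerivAt_sin p)).sub
      (((Real.hasDerivAt_cos p).const_mul m).mul h1.sin)
  refine h2.congr_deriv ?_
  field_simp
  ring

lemma hasDerivAt_g₂_left (p : ℝ) {m : ℝ} (hm : 0 < m) :
    HasDerivAt (fun p => g₂ p m) (Real.sin (p / m) * (p * Real.sin p)
      + (1 / m) * Real.cos (p / m) * tanFun p - m ^ 2 * (Real.cos p * tanFun (p / m)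
      + Real.sin p * (1 / m * (p / m * Real.sin (p / m))))) p := by
  have h1 : HasDerivAt (fun p : ℝ => p / m) (1 / m) p := (hasDerivAt_id p).div_const m
  have h3 : HasDerivAt (fun p => tanFun (p / m)) (p / m * Real.sin (p / m) * (1 / m)) p :=
    HasDerivAt.comp (h₂ := tanFun) p (hasDerivAt_tanFun (p / m)) h1
  have h2 := (h1.sin.mul (hasDerivAt_tanFun p)).sub
      (((Real.hasDerivAt_sin p).mul h3).const_mul (m ^ 2))
  have e : (fun p => g₂ p m) = (fun p => Real.sin (p / m) * tanFun p -
      m ^ 2 * (Real.sin p * tanFun (p / m))) := funext fun p => g₂_eq hm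
  rw [e]
  refine h2.congr_deriv ?_
  ring

/-- Division by p makes the derivative factor, which brings g₂ into the same framework as g₁. It
affects neither positive zeros nor signs at p > 0. -/
lemma hasDerivAt_g₂_div {p m : ℝ} (hp : 0 < p) (hm : 0 < m) :
    HasDerivAt (fun p => g₂ p m / p)
      (-((1 - m ^ 2) / p ^ 2 * (tanFun p * tanFun (p / m)))) p := by
  refine ((hasDerivAt_g₂_left p hm).div (hasDerivAt_id p) hp.ne').congr_deriv ?_
  rw [g₂_eq hm]
  unfold tanFun
  simp only [id]
  field_simp
  ring

lemma oscillation_g₁ {m : ℝ} (hm : 0 < m) (hm1 : m < 1) :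
    Oscillation m (fun j => j * Real.pi) Real.sin Real.cos (fun p => g₁ p m) where
  m_pos := hm
  m_lt := hm1
  z_zero := by simp
  z_mono := strictMono_nat_of_lt_succ fun j => by
    push_cast; nlinarith [Real.pi_pos]
  S_zero := Real.sin_nat_mul_pi
  S_sign j x hx := sin_sign hx.1 (by have := hx.2; push_cast at this; exact this)
  T_sign j _ := by
    rw [Real.cos_nat_mul_pi, Oscillation.sign_mul_self]; norm_num
  lim := by
    have h := (hasDerivAt_g₁_left 0 hm).continuousAt.tendsto.mono_left
      (nhdsWithin_le_nhds (s := Ioi 0))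
    have h0 : g₁ 0 m = 0 := by simp [g₁]
    rwa [h0] at h
  deriv p hp := ⟨1 / m - m, by
    rw [sub_pos, lt_div_iff₀ hm]; nlinarith, (hasDerivAt_g₁_left p hm).congr_deriv (by ring)⟩
  eq p hp := ⟨1, m, one_pos, hm, by unfold g₁; ring⟩

lemma oscillation_g₂ {m : ℝ} (hm : 0 < m) (hm1 : m < 1) :
    Oscillation m tanRoot tanFun Real.sin (fun p => g₂ p m / p) where
  m_pos := hm
  m_lt := hm1
  z_zero := tanRoot_zero
  z_mono := strictMono_tanRoot
  S_zero := tanFun_tanRoot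
  S_sign j x hx := tanFun_sign hx.1 hx.2
  T_sign j hj := sin_sign (lt_tanRoot hj) (tanRoot_lt_succ_mul_pi j)
  lim := by
    have h := (hasDerivAt_iff_tendsto_slope_zero.1 (hasDerivAt_g₂_left 0 hm)).mono_left
      (nhdsWithin_mono 0 (fun x hx => ne_of_gt hx) : 𝓝[>] (0 : ℝ) ≤ 𝓝[≠] 0)
    have h0 : g₂ 0 m = 0 := by simp [g₂]
    simp only [h0, zero_add, sub_zero, smul_eq_mul] at h
    have e : ∀ t, t⁻¹ * g₂ t m = g₂ t m / t := fun t => by rw [div_eq_mul_inv, mul_comm]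
    simpa [e, tanFun] using h
  deriv p hp := ⟨(1 - m ^ 2) / p ^ 2, div_pos (by nlinarith) (by positivity),
    hasDerivAt_g₂_div hp hm⟩
  eq p hp := ⟨1 / p, m ^ 2 / p, by positivity, by positivity, by rw [g₂_eq hm]; field_simp⟩

/-! ### Windows containing the first roots -/

lemma g₁_location {m : ℝ} {k : ℕ} (h0 : k / (k + 1 : ℝ) < m) (h1 : m ≤ (k + 1) / (k + 2)) :
    ∃ P, m * ((k + 1) * Real.pi) < P ∧ P ≤ m * ((k + 2) * Real.pi) ∧ g₁ P m = 0 ∧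
      (∀ p, 0 < p → p < P → g₁ p m < 0) ∧
      (∀ p, P < p → p ≤ m * ((k + 2) * Real.pi) → 0 < g₁ p m) ∧
      ∃ e > P, ∀ p ∈ Ioo P e, 0 < g₁ p m := by
  have hpi := Real.pi_pos
  have hm : 0 < m := lt_of_le_of_lt (by positivity) h0
  have hm1 : m < 1 := h1.trans_lt (by rw [div_lt_one (by positivity)]; linarith)
  have h := (oscillation_g₁ hm hm1).exists_first_zero (j := k) (fun i hi => ?_) ?_
  · push_cast at h; exact h
  · have hik : (i : ℝ) ≤ k := by exact_mod_cast Nat.lt_succ_iff.1 hi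
    rw [div_lt_iff₀ (by positivity)] at h0
    have : (i : ℝ) < m * (i + 1) := by nlinarith
    push_cast
    nlinarith
  · rw [le_div_iff₀ (by positivity)] at h1
    push_cast
    nlinarith

/-- Makes the single condition on the last ratio imply all earlier interlacing inequalities. The
fraction (2n+1)/(2n+3) lies above one ratio and below the lower bound for the next. -/
lemma tanRoot_ratio_le {i j : ℕ} (h : i ≤ j) :
    tanRoot i / tanRoot (i + 1) ≤ tanRoot j / tanRoot (j + 1) := by
  refine monotone_nat_of_le_succ (f := fun i => tanRoot i / tanRoot (i + 1)) (fun n => ?_) h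
  have a := tanRoot_pos (j := n + 1) (by omega)
  have b := tanRoot_pos (j := n + 2) (by omega)
  have h1 := tanRoot_ratio_lt n
  have h2 := lt_tanRoot_ratio (k := n + 1) (by omega)
  push_cast at h2
  have e1 : tanRoot n / tanRoot (n + 1) ≤ (2 * n + 1) / (2 * n + 3) := by
    rw [div_le_div_iff₀ a (by positivity)]; linarith
  have e2 : (4 * ((n : ℝ) + 1) ^ 2 + 6 * (n + 1) + 1) / (4 * ((n : ℝ) + 1) ^ 2 + 10 * (n + 1) + 5)
      ≤ tanRoot (n + 1) / tanRoot (n + 2) := by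
    rw [div_le_div_iff₀ (by positivity) b]; linarith
  refine e1.trans (le_trans ?_ e2)
  rw [div_le_div_iff₀ (by positivity) (by positivity)]
  have : (0 : ℝ) ≤ n := by positivity
  nlinarith

lemma g₂_location {m : ℝ} {k : ℕ} (h0 : tanRoot k / tanRoot (k + 1) < m)
    (h1 : m ≤ tanRoot (k + 1) / tanRoot (k + 2)) :
    ∃ P, m * tanRoot (k + 1) < P ∧ P ≤ m * tanRoot (k + 2) ∧ g₂ P m = 0 ∧
      (∀ p, 0 < p → p < P → g₂ p m < 0) ∧
      (∀ p, P < p → p ≤ m * tanRoot (k + 2) → 0 < g₂ p m) ∧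
      ∃ e > P, ∀ p ∈ Ioo P e, 0 < g₂ p m := by
  have a := tanRoot_pos (j := k + 1) (by omega)
  have b := tanRoot_pos (j := k + 2) (by omega)
  have c : 0 ≤ tanRoot k := by rw [← tanRoot_zero]; exact strictMono_tanRoot.monotone (by omega)
  have hm : 0 < m := lt_of_le_of_lt (by positivity) h0
  have hm1 : m < 1 := h1.trans_lt (by
    rw [div_lt_one (by positivity)]; exact strictMono_tanRoot (by omega))
  obtain ⟨P, c1, c2, c3, c4, c5, e, c6, c7⟩ :=
    (oscillation_g₂ hm hm1).exists_first_zero (j := k)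
    (fun i hi => by
      have := (tanRoot_ratio_le (Nat.lt_succ_iff.1 hi)).trans_lt h0
      rwa [div_lt_iff₀ (tanRoot_pos (by omega))] at this)
    (by rwa [le_div_iff₀ b] at h1)
  have hP : 0 < P := lt_trans (by positivity) c1
  refine ⟨P, c1, c2, (div_eq_zero_iff.1 c3).resolve_right hP.ne', fun p hp hpP => ?_,
    fun p hp hp' => ?_, e, c6, fun p hp => ?_⟩
  · have := c4 p hp hpP
    rwa [div_lt_iff₀ hp, zero_mul] at this
  · have := c5 p hp hp'
    rwa [lt_div_iff₀ (hP.trans hp), zero_mul] at this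
  · have := c7 p hp
    rwa [lt_div_iff₀ (hP.trans hp.1), zero_mul] at this

lemma isLeast_of_neg {g : ℝ → ℝ} {P : ℝ} (hP : 0 < P) (h0 : g P = 0)
    (h : ∀ p, 0 < p → p < P → g p < 0) : IsLeast {p : ℝ | 0 < p ∧ g p = 0} P :=
  ⟨⟨hP, h0⟩, fun p hp => by
    by_contra! hlt
    exact (h p hp.1 hlt).ne hp.2⟩

lemma p₁_spec {m : ℝ} {k : ℕ} (h0 : k / (k + 1 : ℝ) < m) (h1 : m ≤ (k + 1) / (k + 2)) :
    IsLeast {p : ℝ | 0 < p ∧ g₁ p m = 0} (p₁ m) ∧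
    m * ((k + 1) * Real.pi) < p₁ m ∧ p₁ m ≤ m * ((k + 2) * Real.pi) ∧
      (∀ p, 0 < p → p < p₁ m → g₁ p m < 0) ∧
      (∀ p, p₁ m < p → p ≤ m * ((k + 2) * Real.pi) → 0 < g₁ p m) ∧
      ∃ e > p₁ m, ∀ p ∈ Ioo (p₁ m) e, 0 < g₁ p m := by
  obtain ⟨P, c1, c2, c3, c4, c5, c6⟩ := g₁_location h0 h1
  have hm : 0 < m := lt_of_le_of_lt (by positivity) h0
  have hP : 0 < P := lt_trans (by have := Real.pi_pos; positivity) c1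
  have hL := isLeast_of_neg hP c3 c4
  have e : p₁ m = P := hL.csInf_eq
  rw [e]
  exact ⟨hL, c1, c2, c4, c5, c6⟩

lemma tanRoot_ratio_nonneg (k : ℕ) : 0 ≤ tanRoot k / tanRoot (k + 1) := by
  have a := tanRoot_pos (j := k + 1) (by omega)
  have c : 0 ≤ tanRoot k := by rw [← tanRoot_zero]; exact strictMono_tanRoot.monotone (by omega)
  positivity

lemma p₂_spec {m : ℝ} {k : ℕ} (h0 : tanRoot k / tanRoot (k + 1) < m)
    (h1 : m ≤ tanRoot (k + 1) / tanRoot (k + 2)) :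
    IsLeast {p : ℝ | 0 < p ∧ g₂ p m = 0} (p₂ m) ∧
    m * tanRoot (k + 1) < p₂ m ∧ p₂ m ≤ m * tanRoot (k + 2) ∧
      (∀ p, 0 < p → p < p₂ m → g₂ p m < 0) ∧
      (∀ p, p₂ m < p → p ≤ m * tanRoot (k + 2) → 0 < g₂ p m) ∧
      ∃ e > p₂ m, ∀ p ∈ Ioo (p₂ m) e, 0 < g₂ p m := by
  obtain ⟨P, c1, c2, c3, c4, c5, c6⟩ := g₂_location h0 h1
  have hm : 0 < m := (tanRoot_ratio_nonneg k).trans_lt h0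
  have hP : 0 < P := lt_trans (mul_pos hm (tanRoot_pos (by omega))) c1
  have hL := isLeast_of_neg hP c3 c4
  have e : p₂ m = P := hL.csInf_eq
  rw [e]
  exact ⟨hL, c1, c2, c4, c5, c6⟩

lemma exists_index {r : ℕ → ℝ} {m : ℝ} (h0 : r 0 < m) (h : ∃ n, m ≤ r n) :
    ∃ k, r k < m ∧ m ≤ r (k + 1) := by
  classical
  have hs := Nat.find_spec h
  have hne : Nat.find h ≠ 0 := fun e => by rw [e] at hs; exact absurd hs (not_le.2 h0)
  obtain ⟨k, hk⟩ := Nat.exists_eq_succ_of_ne_zero hne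
  refine ⟨k, not_le.1 (Nat.find_min h (by omega)), ?_⟩
  rw [hk] at hs
  exact hs

lemma exists_index_nat {m : ℝ} (hm : 0 < m) (hm1 : m < 1) :
    ∃ k : ℕ, k / (k + 1 : ℝ) < m ∧ m ≤ (k + 1) / (k + 2) := by
  obtain ⟨k, h1, h2⟩ := exists_index (r := fun n => (n : ℝ) / (n + 1)) (m := m) (by simpa using hm) (by
    obtain ⟨n, hn⟩ := exists_nat_gt (1 / (1 - m))
    refine ⟨n, ?_⟩
    rw [div_lt_iff₀ (by linarith)] at hn
    rw [le_div_iff₀ (by positivity)]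
    nlinarith)
  refine ⟨k, h1, h2.trans_eq ?_⟩
  push_cast
  ring

lemma div_succ_lt_tanRoot_ratio {k : ℕ} (hk : 1 ≤ k) :
    (k / (k + 1) : ℝ) < tanRoot k / tanRoot (k + 1) := by
  have h := lt_tanRoot_ratio hk
  have a := tanRoot_pos (j := k + 1) (by omega)
  refine lt_trans ?_ (show ((4 * (k : ℝ) ^ 2 + 6 * k + 1) / (4 * k ^ 2 + 10 * k + 5)) < _ from ?_)
  · rw [div_lt_div_iff₀ (by positivity) (by positivity)]
    nlinarith [(Nat.cast_nonneg k : (0 : ℝ) ≤ k)]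
  · rw [div_lt_div_iff₀ (by positivity) a]
    linarith

lemma tanRoot_ratio_lt_div (k : ℕ) :
    tanRoot k / tanRoot (k + 1) < (2 * k + 1) / (2 * k + 3) := by
  rw [div_lt_div_iff₀ (tanRoot_pos (by omega)) (by positivity)]
  linarith [tanRoot_ratio_lt k]

lemma two_mul_div_lt (k : ℕ) : ((2 * k + 1) / (2 * k + 3) : ℝ) < (k + 1) / (k + 2) := by
  rw [div_lt_div_iff₀ (by positivity) (by positivity)]
  nlinarith

lemma tanRoot_ratio_lt_div_succ (k : ℕ) :
    tanRoot k / tanRoot (k + 1) < (k + 1) / (k + 2) :=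
  (tanRoot_ratio_lt_div k).trans (two_mul_div_lt k)

lemma exists_index_tanRoot {m : ℝ} (hm : 0 < m) (hm1 : m < 1) :
    ∃ k : ℕ, tanRoot k / tanRoot (k + 1) < m ∧ m ≤ tanRoot (k + 1) / tanRoot (k + 2) := by
  obtain ⟨k, -, h2⟩ := exists_index_nat hm hm1
  refine exists_index (r := fun n => tanRoot n / tanRoot (n + 1)) (by simpa [tanRoot_zero] using hm)
    ⟨k + 1, h2.trans ?_⟩
  have := (div_succ_lt_tanRoot_ratio (k := k + 1) (by omega)).le
  push_cast at this
  refine le_trans (le_of_eq ?_) this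
  ring

lemma div_succ_le_tanRoot_ratio (k : ℕ) :
    (k + 1) / (k + 2) ≤ tanRoot (k + 1) / tanRoot (k + 2) := by
  have := (div_succ_lt_tanRoot_ratio (k := k + 1) (by omega)).le
  push_cast at this
  refine le_trans (le_of_eq ?_) this
  ring

/-! ### Order of the two roots for m < 1 -/

/-- `p₂ < p₁` to the left of the interior crossing. -/
lemma p₂_lt_p₁ {k : ℕ} (hk : 1 ≤ k) {m : ℝ} (h0 : k / (k + 1 : ℝ) < m)
    (h1 : m < tanRoot k / tanRoot (k + 1)) : p₂ m < p₁ m := by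
  obtain ⟨-, a1, a2, a3, a4, -⟩ := p₁_spec h0 (h1.trans (tanRoot_ratio_lt_div_succ k)).le
  obtain ⟨i, rfl⟩ : ∃ i, k = i + 1 := ⟨k - 1, by omega⟩
  have h0' : tanRoot i / tanRoot (i + 1) < m := by
    refine (tanRoot_ratio_lt_div_succ i).trans (lt_of_le_of_lt (le_of_eq ?_) h0)
    push_cast; ring
  obtain ⟨b0, b1, b2, b3, -, -⟩ := p₂_spec h0' h1.le
  have hpi := Real.pi_pos
  have hm : 0 < m := lt_of_le_of_lt (by positivity) h0
  have ht := tanRoot_pos (j := i + 2) (by omega)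
  rw [lt_div_iff₀ ht] at h1
  push_cast at *
  -- In the first case (i+1)π < m (i+2)π < p₁ m already separates the roots. Otherwise the location
  -- of p₂ m fixes all signs.
  rcases le_or_gt (p₂ m) ((i + 1) * Real.pi) with h | h
  · refine h.trans_lt (lt_trans ?_ a1)
    rw [div_lt_iff₀ (by positivity)] at h0
    nlinarith
  have hp2 : 0 < p₂ m := b0.1.1
  have hq : p₂ m / m ≤ tanRoot (i + 2) := by rw [div_le_iff₀ hm]; linarith
  have hq' : tanRoot (i + 1) < p₂ m / m := by rw [lt_div_iff₀ hm]; linarith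
  have h2 : p₂ m < tanRoot (i + 1) := b2.trans_lt h1
  have hs := sin_sign (j := i + 1) (x := p₂ m) (by push_cast; exact h)
    (by have := tanRoot_lt_succ_mul_pi (i + 1); push_cast at this ⊢; linarith)
  have hm1 : m < 1 := by
    have := strictMono_tanRoot (show i + 1 < i + 2 by omega)
    by_contra! h3
    nlinarith
  have hlt : p₂ m < m * tanRoot (i + 2) := by
    refine lt_of_le_of_ne b2 fun e => ?_
    have h3 := b0.1.2
    have e1 : p₂ m / m = tanRoot (i + 2) := by rw [e]; field_simp
    rw [g₂_eq hm, e1, tanFun_tanRoot, mul_zero, mul_zero, sub_zero] at h3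
    have h4 := sin_sign (lt_tanRoot (j := i + 2) (by omega)) (tanRoot_lt_succ_mul_pi (i + 2))
    have h5 := tanFun_sign_left (j := i + 1) (x := p₂ m) (by push_cast; linarith) h2
    rcases mul_eq_zero.1 h3 with h6 | h6
    · rw [h6] at h4; simp at h4
    · rw [h6] at h5; simp at h5
  -- Both factors have the sign (-1)^(i+1). So g₁ is negative at p₂ m, whereas it would be positive
  -- there if p₁ m came earlier.
  have hY : 0 < Real.sin (p₂ m) * tanFun (p₂ m / m) :=
    Oscillation.mul_pos_of_sign hs (tanFun_sign hq' (by rw [div_lt_iff₀ hm]; linarith))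
  have hg := g₁_mul_eq (p := p₂ m) hm
  rw [b0.1.2] at hg
  have hneg : g₁ (p₂ m) m < 0 := by
    by_contra! h3
    have h4 : 0 ≤ p₂ m * g₁ (p₂ m) m := by positivity
    have h5 : 0 < m * ((1 - m ^ 2) * (Real.sin (p₂ m) * tanFun (p₂ m / m))) :=
      mul_pos hm (mul_pos (by nlinarith) hY)
    linarith
  by_contra! h3
  rcases h3.lt_or_eq with h4 | h4
  · have h5 := a4 _ h4 (b2.trans (mul_le_mul_of_nonneg_left (by
      have := tanRoot_lt_succ_mul_pi (i + 2)
      push_cast at this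
      linarith) hm.le))
    linarith
  · have h5 := (p₁_spec (k := i + 1) (by push_cast; exact h0)
      ((le_of_lt ((lt_div_iff₀ ht).2 h1)).trans (tanRoot_ratio_lt_div_succ (i + 1)).le)).1.1.2
    rw [h4] at h5
    exact hneg.ne h5

/-- `p₁ < p₂` to the right of the interior crossing. -/
lemma p₁_lt_p₂ {k : ℕ} {m : ℝ} (h0 : tanRoot k / tanRoot (k + 1) < m)
    (h1 : m < (k + 1) / (k + 2)) : p₁ m < p₂ m := by
  have hpi := Real.pi_pos
  have hm : 0 < m := (tanRoot_ratio_nonneg k).trans_lt h0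
  have hm1 : m < 1 := h1.trans (by rw [div_lt_one (by positivity)]; linarith)
  have h0' : (k / (k + 1) : ℝ) < m := by
    rcases Nat.eq_zero_or_pos k with rfl | hk
    · simpa using hm
    · exact (div_succ_lt_tanRoot_ratio hk).trans h0
  obtain ⟨a0, a1, a2, a3, -, -⟩ := p₁_spec h0' h1.le
  obtain ⟨b0, b1, b2, b3, b4, -⟩ := p₂_spec h0 (h1.le.trans (div_succ_le_tanRoot_ratio k))
  rcases le_or_gt (p₁ m) (m * tanRoot (k + 1)) with h | h
  · exact h.trans_lt b1
  have hle2 : ((k : ℝ) + 2) * Real.pi < tanRoot (k + 2) := by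
    have := lt_tanRoot (j := k + 2) (by omega); push_cast at this; exact this
  have hle1 : m * ((k + 2) * Real.pi) < (k + 1) * Real.pi := by
    rw [lt_div_iff₀ (by positivity)] at h1; nlinarith
  have hs := sin_sign (j := k) (x := p₁ m) (by
    refine lt_trans ?_ a1
    rw [div_lt_iff₀ (by positivity)] at h0'; nlinarith) (by linarith)
  have hS := tanFun_sign (j := k + 1) (x := p₁ m / m) (by rw [lt_div_iff₀ hm]; linarith)
    (by
      rw [div_lt_iff₀ hm]
      refine a2.trans_lt ?_
      have := mul_lt_mul_of_pos_left hle2 hm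
      linarith)
  -- Now the factors have opposite signs, so g₂ is negative at p₁ m, whereas it would be positive
  -- there if p₂ m came earlier.
  have hY := Oscillation.mul_neg_of_sign hs hS
  have hg := g₁_mul_eq (p := p₁ m) hm
  rw [a0.1.2, mul_zero] at hg
  have h3 : g₂ (p₁ m) m < 0 := by
    have h4 := (mul_eq_zero.1 hg.symm).resolve_left hm.ne'
    have h5 : (1 - m ^ 2) * (Real.sin (p₁ m) * tanFun (p₁ m / m)) < 0 :=
      mul_neg_of_pos_of_neg (by nlinarith) hY
    linarith
  by_contra! h4
  rcases h4.lt_or_eq with h5 | h5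
  · have h6 := b4 _ h5 (a2.trans (mul_le_mul_of_nonneg_left hle2.le hm.le))
    linarith
  · rw [← h5] at h3
    exact h3.ne b0.1.2

/-! ### Values at the crossings -/

/-- Positivity beyond the first root up to the end of the window leaves no second root there, so
exhibiting one root in the window identifies it. -/
lemma p₁_eq_of_root {m : ℝ} {k : ℕ} (h0 : k / (k + 1 : ℝ) < m) (h1 : m ≤ (k + 1) / (k + 2)) {P : ℝ}
    (hP : m * ((k + 1) * Real.pi) < P) (hP' : P ≤ m * ((k + 2) * Real.pi)) (h : g₁ P m = 0) :
    p₁ m = P := by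
  obtain ⟨a0, -, -, -, a4, -⟩ := p₁_spec h0 h1
  have hm : 0 < m := lt_of_le_of_lt (by positivity) h0
  have hP0 : 0 < P := lt_trans (by have := Real.pi_pos; positivity) hP
  refine le_antisymm (a0.2 ⟨hP0, h⟩) ?_
  by_contra! hlt
  exact (a4 P hlt hP').ne' h

lemma p₂_eq_of_root {m : ℝ} {k : ℕ} (h0 : tanRoot k / tanRoot (k + 1) < m)
    (h1 : m ≤ tanRoot (k + 1) / tanRoot (k + 2)) {P : ℝ}
    (hP : m * tanRoot (k + 1) < P) (hP' : P ≤ m * tanRoot (k + 2)) (h : g₂ P m = 0) :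
    p₂ m = P := by
  obtain ⟨a0, -, -, -, a4, -⟩ := p₂_spec h0 h1
  have hm : 0 < m := (tanRoot_ratio_nonneg k).trans_lt h0
  have hP0 : 0 < P := lt_trans (mul_pos hm (tanRoot_pos (by omega))) hP
  refine le_antisymm (a0.2 ⟨hP0, h⟩) ?_
  by_contra! hlt
  exact (a4 P hlt hP').ne' h

/-- Here p and p/m are consecutive zeros of `tanFun`, so g₂ vanishes and `g₁_mul_eq` carries the
zero over to g₁. -/
lemma p₁_tanRoot_ratio {k : ℕ} (hk : 1 ≤ k) :
    p₁ (tanRoot k / tanRoot (k + 1)) = tanRoot k := by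
  have a := tanRoot_pos hk
  have b := tanRoot_pos (j := k + 1) (by omega)
  have c1 := lt_tanRoot (j := k + 1) (by omega)
  have c2 := tanRoot_lt_succ_mul_pi (k + 1)
  push_cast at c1 c2
  refine p₁_eq_of_root (div_succ_lt_tanRoot_ratio hk) (tanRoot_ratio_lt_div_succ k).le ?_ ?_ ?_
  · rw [div_mul_eq_mul_div, div_lt_iff₀ b]; gcongr
  · rw [div_mul_eq_mul_div, le_div_iff₀ b]
    gcongr
    linarith
  · have h := g₁_mul_eq (p := tanRoot k) (div_pos a b)
    have e : tanRoot k / (tanRoot k / tanRoot (k + 1)) = tanRoot (k + 1) := by field_simp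
    rw [g₂_eq (div_pos a b), e, tanFun_tanRoot, tanFun_tanRoot] at h
    simpa [a.ne'] using h

lemma p₂_tanRoot_ratio {k : ℕ} (hk : 1 ≤ k) :
    p₂ (tanRoot k / tanRoot (k + 1)) = tanRoot k := by
  obtain ⟨i, rfl⟩ : ∃ i, k = i + 1 := ⟨k - 1, by omega⟩
  have a := tanRoot_pos hk
  have b := tanRoot_pos (j := i + 2) (by omega)
  have c := strictMono_tanRoot (show i + 1 < i + 2 by omega)
  refine p₂_eq_of_root
    ((tanRoot_ratio_lt_div_succ i).trans_le (div_succ_le_tanRoot_ratio i)) le_rfl ?_ ?_ ?_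
  · rw [div_mul_eq_mul_div, div_lt_iff₀ b]; gcongr
  · rw [div_mul_cancel₀ _ b.ne']
  · have e : tanRoot (i + 1) / (tanRoot (i + 1) / tanRoot (i + 2)) = tanRoot (i + 2) := by
      field_simp
    rw [g₂_eq (div_pos a b), e, tanFun_tanRoot, tanFun_tanRoot]
    simp

lemma p₁_div_succ {k : ℕ} (hk : 1 ≤ k) : p₁ ((k : ℝ) / (k + 1)) = Real.pi * k := by
  obtain ⟨i, rfl⟩ : ∃ i, k = i + 1 := ⟨k - 1, by omega⟩
  have hpi := Real.pi_pos
  push_cast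
  have e : ((i : ℝ) + 1 + 1) = i + 2 := by ring
  rw [e]
  refine p₁_eq_of_root (k := i) ?_ le_rfl ?_ ?_ ?_
  · rw [div_lt_div_iff₀ (by positivity) (by positivity)]; nlinarith
  · rw [div_mul_eq_mul_div, div_lt_iff₀ (by positivity)]
    have : 0 < (i + 1) * Real.pi := by positivity
    nlinarith
  · apply le_of_eq; field_simp
  · have e1 : Real.pi * (i + 1) / (((i : ℝ) + 1) / (i + 2)) = (i + 2 : ℕ) * Real.pi := by
      push_cast; field_simp
    have e2 : Real.pi * (i + 1) = (i + 1 : ℕ) * Real.pi := by push_cast; ring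
    rw [g₁, e1, e2, Real.sin_nat_mul_pi, Real.sin_nat_mul_pi]
    simp

lemma p₂_div_succ {k : ℕ} (hk : 1 ≤ k) : p₂ ((k : ℝ) / (k + 1)) = Real.pi * k := by
  obtain ⟨i, rfl⟩ : ∃ i, k = i + 1 := ⟨k - 1, by omega⟩
  have hpi := Real.pi_pos
  push_cast
  have e : ((i : ℝ) + 1 + 1) = i + 2 := by ring
  rw [e]
  have c1 := tanRoot_lt_succ_mul_pi (i + 1)
  have c2 := le_tanRoot (i + 2)
  push_cast at c1 c2
  refine p₂_eq_of_root (k := i) (tanRoot_ratio_lt_div_succ i) (div_succ_le_tanRoot_ratio i) ?_ ?_ ?_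
  · rw [div_mul_eq_mul_div, div_lt_iff₀ (by positivity)]
    have : 0 < (i + 1 : ℝ) := by positivity
    nlinarith
  · rw [div_mul_eq_mul_div, le_div_iff₀ (by positivity)]
    have : 0 < (i + 1 : ℝ) := by positivity
    nlinarith
  · have e1 : Real.pi * (i + 1) / (((i : ℝ) + 1) / (i + 2)) = (i + 2 : ℕ) * Real.pi := by
      push_cast; field_simp
    have e2 : Real.pi * (i + 1) = (i + 1 : ℕ) * Real.pi := by push_cast; ring
    rw [g₂, e1, e2, Real.sin_nat_mul_pi, Real.sin_nat_mul_pi]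
    simp

/-! ### Continuity and behaviour at 1 -/

lemma differentiableAt_g₁ (p : ℝ) {m : ℝ} (hm : m ≠ 0) :
    DifferentiableAt ℝ (fun x : ℝ × ℝ => g₁ x.1 x.2) (p, m) := by
  unfold g₁
  have h : DifferentiableAt ℝ (fun x : ℝ × ℝ => x.1 / x.2) (p, m) := by
    simp only [div_eq_mul_inv]
    exact differentiableAt_fst.fun_mul (differentiableAt_snd.fun_inv hm)
  fun_prop

lemma differentiableAt_g₂ (p : ℝ) {m : ℝ} (hm : m ≠ 0) :
    DifferentiableAt ℝ (fun x : ℝ × ℝ => g₂ x.1 x.2) (p, m) := by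
  unfold g₂
  have h : DifferentiableAt ℝ (fun x : ℝ × ℝ => x.1 / x.2) (p, m) := by
    simp only [div_eq_mul_inv]
    exact differentiableAt_fst.fun_mul (differentiableAt_snd.fun_inv hm)
  fun_prop

/-- The first zero depends continuously on the parameter where the sign changes at it. -/
lemma continuousAt_first_zero {g : ℝ → ℝ → ℝ} {P : ℝ → ℝ} {m₀ η : ℝ}
    (hg : ∀ p, 0 < p → ContinuousAt (fun x : ℝ × ℝ => g x.1 x.2) (p, m₀))
    (hc : ∀ m, Continuous fun p => g p m) (hη : 0 < η)
    (hL : ∀ᶠ m in 𝓝 m₀, IsLeast {p : ℝ | 0 < p ∧ g p m = 0} (P m))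
    (hlow : ∀ᶠ m in 𝓝 m₀, η ≤ P m)
    (hneg : ∀ p, 0 < p → p < P m₀ → g p m₀ < 0)
    (hpos : ∃ e > P m₀, ∀ p ∈ Ioo (P m₀) e, 0 < g p m₀) : ContinuousAt P m₀ := by
  have hP0 : 0 < P m₀ := hL.self_of_nhds.1.1
  refine tendsto_order.2 ⟨fun a ha => ?_, fun b hb => ?_⟩
  · have hK : ∀ᶠ m in 𝓝 m₀, ∀ p ∈ Icc η a, g p m < 0 := by
      refine isCompact_Icc.eventually_forall_of_forall_eventually fun p hp => ?_
      have hp0 := hη.trans_le hp.1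
      have h : ContinuousAt (fun x : ℝ × ℝ => g x.2 x.1) (m₀, p) :=
        ContinuousAt.comp (f := Prod.swap) (g := fun x : ℝ × ℝ => g x.1 x.2) (hg p hp0)
          continuous_swap.continuousAt
      exact h.eventually (gt_mem_nhds (hneg p hp0 (hp.2.trans_lt ha)))
    filter_upwards [hK, hL, hlow] with m h1 h2 h3
    by_contra! h4
    exact (h1 _ ⟨h3, h4⟩).ne h2.1.2
  · obtain ⟨e, he, hpe⟩ := hpos
    -- The signs at half the root and at v, just behind it, persist, which traps a root below b.
    obtain ⟨v, hv1, hv2⟩ := exists_between (lt_min he hb)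
    have hv3 := lt_min_iff.1 hv2
    have hm : ∀ p, 0 < p → ContinuousAt (fun m => g p m) m₀ := fun p hp =>
      ContinuousAt.comp (f := fun m => (p, m)) (g := fun x : ℝ × ℝ => g x.1 x.2) (hg p hp)
        (by fun_prop)
    have hu := (hm (P m₀ / 2) (by positivity)).eventually
      (gt_mem_nhds (hneg (P m₀ / 2) (by positivity) (by linarith)))
    have hv := (hm v (hP0.trans hv1)).eventually (lt_mem_nhds (hpe v ⟨hv1, hv3.1⟩))
    filter_upwards [hu, hv, hL] with m h1 h2 h3
    obtain ⟨p, hp, hp0⟩ := intermediate_value_Icc (show P m₀ / 2 ≤ v by linarith)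
      (hc m).continuousOn (show (0 : ℝ) ∈ _ from ⟨h1.le, h2.le⟩)
    have : P m ≤ p := h3.2 ⟨lt_of_lt_of_le (by positivity) hp.1, hp0⟩
    linarith [hp.2, hv3.2]

lemma isLeast_p₁ {m : ℝ} (hm : 0 < m) (hm1 : m < 1) :
    IsLeast {p : ℝ | 0 < p ∧ g₁ p m = 0} (p₁ m) := by
  obtain ⟨k, h0, h1⟩ := exists_index_nat hm hm1
  exact (p₁_spec h0 h1).1

lemma isLeast_p₂ {m : ℝ} (hm : 0 < m) (hm1 : m < 1) :
    IsLeast {p : ℝ | 0 < p ∧ g₂ p m = 0} (p₂ m) := by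
  obtain ⟨k, h0, h1⟩ := exists_index_tanRoot hm hm1
  exact (p₂_spec h0 h1).1

/-- A parameter in a later window only has a larger lower bound. The case n = 0 gives the cutoff for
continuity, and large n the divergence at 1. -/
lemma mul_pi_lt_p₁ {m : ℝ} {n : ℕ} (hn : n / (n + 1 : ℝ) < m) (hm1 : m < 1) :
    m * ((n + 1) * Real.pi) < p₁ m := by
  have hpi := Real.pi_pos
  have hm : 0 < m := lt_of_le_of_lt (by positivity) hn
  obtain ⟨k, h0, h1⟩ := exists_index_nat hm hm1
  refine lt_of_le_of_lt ?_ (p₁_spec h0 h1).2.1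
  have : (n : ℝ) ≤ k := by
    have h2 := hn.trans_le h1
    rw [div_lt_div_iff₀ (by positivity) (by positivity)] at h2
    have h3 : (n : ℝ) < (k + 1 : ℕ) := by push_cast; nlinarith
    exact_mod_cast Nat.lt_succ_iff.1 (by exact_mod_cast h3)
  gcongr

lemma mul_pi_lt_p₂ {m : ℝ} {n : ℕ} (hn : tanRoot n / tanRoot (n + 1) < m) (hm1 : m < 1) :
    m * ((n + 1) * Real.pi) < p₂ m := by
  have hpi := Real.pi_pos
  have hm : 0 < m := (tanRoot_ratio_nonneg n).trans_lt hn
  obtain ⟨k, h0, h1⟩ := exists_index_tanRoot hm hm1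
  refine lt_of_le_of_lt ?_ (p₂_spec h0 h1).2.1
  have hnk : n ≤ k := by
    by_contra! hlt
    exact absurd (hn.trans_le h1) (not_lt.2 (tanRoot_ratio_le (show k + 1 ≤ n by omega)))
  have h2 := le_tanRoot (n + 1)
  have h3 := strictMono_tanRoot.monotone (show n + 1 ≤ k + 1 by omega)
  push_cast at h2
  exact mul_le_mul_of_nonneg_left (h2.trans h3) hm.le

lemma continuousAt_p₁_of_lt {m : ℝ} (hm : 0 < m) (hm1 : m < 1) : ContinuousAt p₁ m := by
  obtain ⟨k, h0, h1⟩ := exists_index_nat hm hm1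
  obtain ⟨-, -, -, a3, -, a5⟩ := p₁_spec h0 h1
  have hev : ∀ᶠ x in 𝓝 m, x ∈ Ioo (m / 2) 1 := Ioo_mem_nhds (by linarith) hm1
  refine continuousAt_first_zero (η := m / 2 * Real.pi)
    (fun p _ => (differentiableAt_g₁ p hm.ne').continuousAt)
    (fun m => by unfold g₁; fun_prop) (by have := Real.pi_pos; positivity) ?_ ?_ a3 a5
  · filter_upwards [hev] with x hx
    exact isLeast_p₁ (by linarith [hx.1]) hx.2
  · filter_upwards [hev] with x hx
    have := mul_pi_lt_p₁ (n := 0) (m := x) (by simp; linarith [hx.1]) hx.2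
    simp at this
    nlinarith [Real.pi_pos, hx.1]

lemma continuousAt_p₂_of_lt {m : ℝ} (hm : 0 < m) (hm1 : m < 1) : ContinuousAt p₂ m := by
  obtain ⟨k, h0, h1⟩ := exists_index_tanRoot hm hm1
  obtain ⟨-, -, -, a3, -, a5⟩ := p₂_spec h0 h1
  have hev : ∀ᶠ x in 𝓝 m, x ∈ Ioo (m / 2) 1 := Ioo_mem_nhds (by linarith) hm1
  refine continuousAt_first_zero (η := m / 2 * Real.pi)
    (fun p _ => (differentiableAt_g₂ p hm.ne').continuousAt)
    (fun m => by unfold g₂; fun_prop) (by have := Real.pi_pos; positivity) ?_ ?_ a3 a5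
  · filter_upwards [hev] with x hx
    exact isLeast_p₂ (by linarith [hx.1]) hx.2
  · filter_upwards [hev] with x hx
    have := mul_pi_lt_p₂ (n := 0) (m := x) (by simp [tanRoot_zero]; linarith [hx.1]) hx.2
    simp at this
    nlinarith [Real.pi_pos, hx.1]

lemma tendsto_left_of_lower_bound {P : ℝ → ℝ} {r : ℕ → ℝ} (hr : ∀ n, r n < 1)
    (h : ∀ n m, r n < m → m < 1 → m * ((n + 1) * Real.pi) < P m) :
    Tendsto P (𝓝[<] 1) atTop := by
  refine tendsto_atTop.2 fun b => ?_
  obtain ⟨n, hn⟩ := exists_nat_gt b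
  have h2 : max (r n) (1 / 2) < 1 := max_lt (hr n) (by norm_num)
  filter_upwards [Ioo_mem_nhdsLT h2] with m hm
  have h3 := max_lt_iff.1 hm.1
  have h4 := h n m h3.1 hm.2
  have h5 : (1 / 2 : ℝ) * ((n + 1) * Real.pi) ≤ m * ((n + 1) * Real.pi) :=
    mul_le_mul_of_nonneg_right h3.2.le (by have := Real.pi_pos; positivity)
  have h6 : (0 : ℝ) ≤ n := by positivity
  nlinarith [Real.pi_gt_three]

lemma tendsto_p₁_left : Tendsto p₁ (𝓝[<] 1) atTop :=
  tendsto_left_of_lower_bound (r := fun n => n / (n + 1 : ℝ))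
    (fun n => by rw [div_lt_one (by positivity)]; linarith) fun _ _ h h1 => mul_pi_lt_p₁ h h1

lemma tendsto_p₂_left : Tendsto p₂ (𝓝[<] 1) atTop :=
  tendsto_left_of_lower_bound (r := fun n => tanRoot n / tanRoot (n + 1))
    (fun n => by
      rw [div_lt_one (tanRoot_pos (by omega))]; exact strictMono_tanRoot (by omega))
    fun _ _ h h1 => mul_pi_lt_p₂ h h1

/-! ### Derivatives of implicit functions -/

/-- The linearized equation satisfied by an implicit function. -/
lemma implicit_isLittleO {g : ℝ → ℝ → ℝ} {P : ℝ → ℝ} {m₀ A B : ℝ}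
    (hg : DifferentiableAt ℝ (fun x : ℝ × ℝ => g x.1 x.2) (P m₀, m₀))
    (hA : HasDerivAt (fun p => g p m₀) A (P m₀)) (hB : HasDerivAt (fun m => g (P m₀) m) B m₀)
    (hP : ContinuousAt P m₀) (h0 : ∀ᶠ m in 𝓝 m₀, g (P m) m = 0) :
    (fun m => A * (P m - P m₀) + B * (m - m₀)) =o[𝓝 m₀]
      fun m => |P m - P m₀| + |m - m₀| := by
  obtain ⟨L, hL⟩ := hg
  have eA : L (1, 0) = A := by
    have h1 : HasDerivAt (fun p : ℝ => (p, m₀)) ((1 : ℝ), (0 : ℝ)) (P m₀) :=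
      (hasDerivAt_id _).prodMk (hasDerivAt_const _ _)
    exact (HasFDerivAt.comp_hasDerivAt (l := fun x : ℝ × ℝ => g x.1 x.2) (P m₀) hL h1).unique hA
  have eB : L (0, 1) = B := by
    have h1 : HasDerivAt (fun m : ℝ => (P m₀, m)) ((0 : ℝ), (1 : ℝ)) m₀ :=
      (hasDerivAt_const _ _).prodMk (hasDerivAt_id _)
    exact (HasFDerivAt.comp_hasDerivAt (l := fun x : ℝ × ℝ => g x.1 x.2) m₀ hL h1).unique hB
  have eL : ∀ x y, L (x, y) = A * x + B * y := fun x y => by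
    have : (x, y) = x • ((1 : ℝ), (0 : ℝ)) + y • ((0 : ℝ), (1 : ℝ)) := by simp
    rw [this, map_add, map_smul, map_smul, eA, eB, smul_eq_mul, smul_eq_mul, mul_comm, mul_comm y]
  have ht : Tendsto (fun m => (P m, m)) (𝓝 m₀) (𝓝 (P m₀, m₀)) :=
    (hP.prodMk continuousAt_id).tendsto
  have h1 := hL.isLittleO.comp_tendsto ht
  have h2 : (fun m => -(A * (P m - P m₀) + B * (m - m₀))) =o[𝓝 m₀]
      fun m => (P m, m) - (P m₀, m₀) := by
    refine h1.congr' ?_ (Eventually.of_forall fun m => rfl)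
    filter_upwards [h0] with m hm
    simp only [Function.comp, hm, h0.self_of_nhds, Prod.mk_sub_mk, eL]
    ring
  have h3 := h2.neg_left
  simp only [neg_neg] at h3
  refine h3.trans_isBigO (Asymptotics.IsBigO.of_bound 1 (Eventually.of_forall fun m => ?_))
  rw [Prod.mk_sub_mk, Prod.norm_mk, one_mul, Real.norm_eq_abs, Real.norm_eq_abs, Real.norm_eq_abs,
    abs_of_nonneg (by positivity : 0 ≤ |P m - P m₀| + |m - m₀|)]
  exact max_le (by linarith [abs_nonneg (m - m₀)]) (by linarith [abs_nonneg (P m - P m₀)])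

/-- Since A ≠ 0, the linearized equation first gives ΔP = O(Δm), which improves its error term to
o(Δm). Continuity of `P` and differentiability of `g` at the one point suffice. -/
lemma hasDerivAt_implicit {g : ℝ → ℝ → ℝ} {P : ℝ → ℝ} {m₀ A B : ℝ}
    (hg : DifferentiableAt ℝ (fun x : ℝ × ℝ => g x.1 x.2) (P m₀, m₀))
    (hA : HasDerivAt (fun p => g p m₀) A (P m₀)) (hB : HasDerivAt (fun m => g (P m₀) m) B m₀)
    (hP : ContinuousAt P m₀) (h0 : ∀ᶠ m in 𝓝 m₀, g (P m) m = 0) (hA0 : A ≠ 0) :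
    HasDerivAt P (-B / A) m₀ := by
  have h := implicit_isLittleO hg hA hB hP h0
  have hA1 : 0 < |A| := abs_pos.2 hA0
  have hO : (fun m => |P m - P m₀| + |m - m₀|) =O[𝓝 m₀] fun m => m - m₀ := by
    refine Asymptotics.IsBigO.of_bound (2 * |B| / |A| + 2) ?_
    filter_upwards [h.bound (show 0 < |A| / 2 by positivity)] with m hm
    rw [Real.norm_eq_abs, Real.norm_eq_abs, abs_of_nonneg (by positivity : 0 ≤ |P m - P m₀| + _)]
      at hm
    rw [Real.norm_eq_abs, Real.norm_eq_abs, abs_of_nonneg (by positivity)]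
    have h1 : |A| * |P m - P m₀| ≤ |A * (P m - P m₀) + B * (m - m₀)| + |B| * |m - m₀| := by
      rw [← abs_mul, ← abs_mul]
      calc |A * (P m - P m₀)| = |(A * (P m - P m₀) + B * (m - m₀)) - B * (m - m₀)| := by
            congr 1; ring
        _ ≤ _ := abs_sub _ _
    have h2 : |A| * |P m - P m₀| ≤ (2 * |B| + |A|) * |m - m₀| := by linarith
    have h3 : |P m - P m₀| ≤ (2 * |B| / |A| + 1) * |m - m₀| := by
      have e : (2 * |B| / |A| + 1) * |m - m₀| = (2 * |B| + |A|) * |m - m₀| / |A| := by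
        field_simp
      rw [e, le_div_iff₀ hA1]; linarith
    linarith
  have h4 := (h.trans_isBigO hO).const_mul_left A⁻¹
  refine hasDerivAt_iff_isLittleO.2 (h4.congr_left fun m => ?_)
  simp only [smul_eq_mul]
  field_simp
  ring

/-- With A = 0 the equation reads B Δm = o(|ΔP| + |Δm|), which forces |ΔP/Δm| → ∞. The sign of the
quotient is supplied by `hs`. -/
lemma hasDerivPosInfAt_implicit {g : ℝ → ℝ → ℝ} {P : ℝ → ℝ} {m₀ B : ℝ}
    (hg : DifferentiableAt ℝ (fun x : ℝ × ℝ => g x.1 x.2) (P m₀, m₀))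
    (hA : HasDerivAt (fun p => g p m₀) 0 (P m₀)) (hB : HasDerivAt (fun m => g (P m₀) m) B m₀)
    (hP : ContinuousAt P m₀) (h0 : ∀ᶠ m in 𝓝 m₀, g (P m) m = 0) (hB0 : B ≠ 0)
    (hs : ∀ᶠ m in 𝓝[≠] m₀, 0 < (P m - P m₀) / (m - m₀)) :
    HasDerivPosInfAt P m₀ := by
  have h := implicit_isLittleO hg hA hB hP h0
  have hB1 : 0 < |B| := abs_pos.2 hB0
  refine tendsto_atTop.2 fun b => ?_
  -- This choice yields (|b| + 2)|Δm| ≤ |ΔP| + |Δm|, hence |ΔP| ≥ (|b| + 1)|Δm|.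
  have hc : 0 < |B| / (|b| + 2) := by positivity
  filter_upwards [hs, (h.bound hc).filter_mono nhdsWithin_le_nhds, self_mem_nhdsWithin]
    with m h1 h2 h3
  have hm : 0 < |m - m₀| := abs_pos.2 (sub_ne_zero.2 h3)
  rw [zero_mul, zero_add, Real.norm_eq_abs, Real.norm_eq_abs, abs_mul,
    abs_of_nonneg (by positivity : 0 ≤ |P m - P m₀| + _), div_mul_eq_mul_div,
    le_div_iff₀ (by positivity)] at h2
  have h4 : |m - m₀| * (|b| + 2) ≤ |P m - P m₀| + |m - m₀| := by
    by_contra! h5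
    nlinarith
  rw [← abs_of_pos h1, abs_div]
  refine (le_abs_self b).trans ((le_div_iff₀ hm).2 ?_)
  nlinarith

/-! ### Slopes and crossings for m < 1 -/

lemma mul_div_succ_eq (k : ℕ) (hk : 1 ≤ k) :
    Real.pi * k / ((k : ℝ) / (k + 1)) = (k + 1 : ℕ) * Real.pi := by
  have : (0 : ℝ) < k := by exact_mod_cast hk
  push_cast
  field_simp

lemma cos_mul_cos_div_succ (k : ℕ) (hk : 1 ≤ k) :
    Real.cos (Real.pi * k) * Real.cos (Real.pi * k / ((k : ℝ) / (k + 1))) = -1 := by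
  rw [mul_div_succ_eq k hk, mul_comm Real.pi, Real.cos_nat_mul_pi, Real.cos_nat_mul_pi, pow_succ,
    ← mul_assoc, Oscillation.sign_mul_self]
  norm_num

lemma sin_div_succ (k : ℕ) (hk : 1 ≤ k) : Real.sin (Real.pi * k / ((k : ℝ) / (k + 1))) = 0 := by
  rw [mul_div_succ_eq k hk, Real.sin_nat_mul_pi]

lemma sin_pi_mul_nat (k : ℕ) : Real.sin (Real.pi * k) = 0 := by
  rw [mul_comm, Real.sin_nat_mul_pi]

lemma hasDerivAt_div_right (p : ℝ) {m : ℝ} (hm : m ≠ 0) :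
    HasDerivAt (fun m => p / m) (-p / m ^ 2) m := by
  simpa [div_eq_mul_inv] using (hasDerivAt_inv hm).const_mul p

lemma hasDerivAt_p₂_div_succ {k : ℕ} (hk : 1 ≤ k) :
    HasDerivAt p₂ (Real.pi * k / (((k : ℝ) / (k + 1)) * (1 - ((k : ℝ) / (k + 1)) ^ 2)))
      ((k : ℝ) / (k + 1)) := by
  have hk0 : (0 : ℝ) < k := by exact_mod_cast hk
  have hP := p₂_div_succ hk
  have hq := sin_div_succ k hk
  have hc := cos_mul_cos_div_succ k hk
  set m : ℝ := (k : ℝ) / (k + 1) with hm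
  have hm0 : 0 < m := by positivity
  have hm1 : m < 1 := by rw [hm, div_lt_one (by positivity)]; linarith
  clear_value m
  have hp0 : 0 < Real.pi * k := by have := Real.pi_pos; positivity
  have hA : HasDerivAt (fun p => g₂ p m) (Real.pi * k * (1 / m - m)) (p₂ m) := by
    rw [hP]
    refine (hasDerivAt_g₂_left (Real.pi * k) hm0).congr_deriv ?_
    rw [tanFun, tanFun, hq, sin_pi_mul_nat]
    generalize Real.cos (Real.pi * k) = c at hc ⊢
    generalize Real.cos (Real.pi * k / m) = c' at hc ⊢
    field_simp
    linear_combination (Real.pi * k * (m ^ 2 - 1)) * hc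
  have hB : HasDerivAt (fun x => g₂ (p₂ m) x) (-(Real.pi * k) ^ 2 / m ^ 2) m := by
    rw [hP]
    have e : (fun x => g₂ (Real.pi * k) x) =
        fun x => -(Real.pi * k * Real.cos (Real.pi * k)) * Real.sin (Real.pi * k / x) := by
      funext x; rw [g₂, sin_pi_mul_nat]; ring
    rw [e]
    refine ((hasDerivAt_div_right (Real.pi * k) hm0.ne').sin.const_mul _).congr_deriv ?_
    generalize Real.cos (Real.pi * k) = c at hc ⊢
    generalize Real.cos (Real.pi * k / m) = c' at hc ⊢
    field_simp
    linear_combination hc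
  have hA0 : Real.pi * k * (1 / m - m) ≠ 0 := by
    refine (mul_pos hp0 ?_).ne'
    rw [sub_pos, lt_div_iff₀ hm0]; nlinarith
  refine (hasDerivAt_implicit (differentiableAt_g₂ _ hm0.ne') hA hB
    (continuousAt_p₂_of_lt hm0 hm1) ?_ hA0).congr_deriv ?_
  · filter_upwards [Ioo_mem_nhds hm0 hm1] with x hx
    exact (isLeast_p₂ hx.1 hx.2).1.2
  · have h1 : 1 - m ^ 2 ≠ 0 := by nlinarith
    have e : 1 / m - m = (1 - m ^ 2) / m := by field_simp
    rw [e]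
    field_simp

lemma hasDerivPosInfAt_p₁_div_succ {k : ℕ} (hk : 1 ≤ k) :
    HasDerivPosInfAt p₁ ((k : ℝ) / (k + 1)) := by
  have hk0 : (0 : ℝ) < k := by exact_mod_cast hk
  have hpi := Real.pi_pos
  have hP := p₁_div_succ hk
  have hq := sin_div_succ k hk
  have hc := cos_mul_cos_div_succ k hk
  have hm0 : (0 : ℝ) < k / (k + 1) := by positivity
  have hm1 : (k : ℝ) / (k + 1) < 1 := by rw [div_lt_one (by positivity)]; linarith
  have hp0 : 0 < Real.pi * k := by positivity
  refine hasDerivPosInfAt_implicit (B := -(Real.pi * k) / (k / (k + 1)))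
    (differentiableAt_g₁ _ hm0.ne') ?_ ?_ (continuousAt_p₁_of_lt hm0 hm1) ?_
    (div_ne_zero (by linarith) hm0.ne') ?_
  · rw [hP]
    refine (hasDerivAt_g₁_left (Real.pi * k) hm0).congr_deriv ?_
    rw [sin_pi_mul_nat]; ring
  · rw [hP]
    have e : (fun x => g₁ (Real.pi * k) x) =
        fun x => -Real.cos (Real.pi * k) * (x * Real.sin (Real.pi * k / x)) := by
      funext x; rw [g₁, sin_pi_mul_nat]; ring
    rw [e]
    refine (((hasDerivAt_id _).mul
      (hasDerivAt_div_right (Real.pi * k) hm0.ne').sin).const_mul _).congr_deriv ?_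
    rw [hq]
    generalize Real.cos (Real.pi * k) = c at hc ⊢
    generalize Real.cos (Real.pi * k / (k / (k + 1))) = c' at hc ⊢
    simp only [mul_zero, zero_add]
    field_simp
    linear_combination hc
  · filter_upwards [Ioo_mem_nhds hm0 hm1] with x hx
    exact (isLeast_p₁ hx.1 hx.2).1.2
  -- The neighbourhood stays within the window ending at k/(k+1) on the left. The bounds p₁ x ≤ x
  -- (k+1)π on the left and p₁ x > x (k+1)π on the right give the quotient its sign.
  · have hlow : ((k : ℝ) - 1) / k < k / (k + 1) := by
      rw [div_lt_div_iff₀ hk0 (by positivity)]; nlinarith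
    filter_upwards [nhdsWithin_le_nhds (Ioo_mem_nhds hlow hm1), self_mem_nhdsWithin] with x hx hne
    rw [hP]
    rcases lt_or_gt_of_ne hne with h | h
    · refine div_pos_of_neg_of_neg ?_ (sub_neg.2 h)
      obtain ⟨i, rfl⟩ : ∃ i, k = i + 1 := ⟨k - 1, by omega⟩
      push_cast at *
      have h2 := (p₁_spec (k := i) (m := x) (by simpa using hx.1)
        (h.le.trans_eq (by ring))).2.2.1
      rw [lt_div_iff₀ (by positivity)] at h
      nlinarith
    · refine div_pos ?_ (sub_pos.2 h)
      have h2 := mul_pi_lt_p₁ h hx.2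
      have h' : (k : ℝ) / (k + 1) < x := h
      rw [div_lt_iff₀ (by positivity)] at h'
      nlinarith

lemma graphsCrossAt_tanRoot_ratio {k : ℕ} (hk : 1 ≤ k) :
    GraphsCrossAt p₁ p₂ (tanRoot k / tanRoot (k + 1)) := by
  refine ⟨by rw [p₁_tanRoot_ratio hk, p₂_tanRoot_ratio hk], Or.inr ⟨?_, ?_⟩⟩
  · filter_upwards [Ioo_mem_nhdsLT (div_succ_lt_tanRoot_ratio hk)] with m hm
    exact p₂_lt_p₁ hk hm.1 hm.2
  · filter_upwards [Ioo_mem_nhdsGT (tanRoot_ratio_lt_div_succ k)] with m hm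
    exact p₁_lt_p₂ hm.1 hm.2

lemma graphsCrossAt_div_succ {k : ℕ} (hk : 1 ≤ k) :
    GraphsCrossAt p₁ p₂ ((k : ℝ) / (k + 1)) := by
  refine ⟨by rw [p₁_div_succ hk, p₂_div_succ hk], Or.inl ⟨?_, ?_⟩⟩
  · obtain ⟨i, rfl⟩ : ∃ i, k = i + 1 := ⟨k - 1, by omega⟩
    have h := tanRoot_ratio_lt_div_succ i
    have e : ((i : ℝ) + 1) / (i + 2) = ((i + 1 : ℕ) : ℝ) / ((i + 1 : ℕ) + 1) := by
      push_cast; ring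
    rw [← e]
    filter_upwards [Ioo_mem_nhdsLT h] with m hm
    exact p₁_lt_p₂ hm.1 hm.2
  · filter_upwards [Ioo_mem_nhdsGT (div_succ_lt_tanRoot_ratio hk)] with m hm
    exact p₂_lt_p₁ hk hm.1 hm.2

/-! ### Reflection m ↦ 1/m -/

lemma g₁_mul_inv (q : ℝ) {m : ℝ} (hm : m ≠ 0) : g₁ (m * q) m = -m * g₁ q m⁻¹ := by
  have e : m * q / m = q := by field_simp
  rw [g₁, g₁, e, div_inv_eq_mul, mul_comm q m]
  field_simp
  ring

lemma g₂_mul_inv (q : ℝ) {m : ℝ} (hm : m ≠ 0) : g₂ (m * q) m = -m ^ 2 * g₂ q m⁻¹ := by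
  have e : m * q / m = q := by field_simp
  rw [g₂, g₂, e, div_inv_eq_mul, mul_comm q m]
  field_simp
  ring

lemma isLeast_reflect {g : ℝ → ℝ → ℝ} {m P : ℝ} (hm : 0 < m)
    (h : ∀ q, g (m * q) m = 0 ↔ g q m⁻¹ = 0) (hP : IsLeast {p : ℝ | 0 < p ∧ g p m⁻¹ = 0} P) :
    IsLeast {p : ℝ | 0 < p ∧ g p m = 0} (m * P) := by
  refine ⟨⟨mul_pos hm hP.1.1, (h P).2 hP.1.2⟩, fun p hp => ?_⟩
  have e : m * (p / m) = p := by field_simp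
  have h1 : P ≤ p / m := hP.2 ⟨div_pos hp.1 hm, (h _).1 (by rw [e]; exact hp.2)⟩
  rwa [le_div_iff₀ hm, mul_comm] at h1

lemma isLeast_p₁_reflect {m : ℝ} (hm : 1 < m) :
    IsLeast {p : ℝ | 0 < p ∧ g₁ p m = 0} (m * p₁ m⁻¹) := by
  have hm0 : 0 < m := by linarith
  exact isLeast_reflect hm0 (fun q => by rw [g₁_mul_inv q hm0.ne']; simp [hm0.ne'])
    (isLeast_p₁ (inv_pos.2 hm0) (inv_lt_one_of_one_lt₀ hm))

lemma isLeast_p₂_reflect {m : ℝ} (hm : 1 < m) :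
    IsLeast {p : ℝ | 0 < p ∧ g₂ p m = 0} (m * p₂ m⁻¹) := by
  have hm0 : 0 < m := by linarith
  exact isLeast_reflect hm0 (fun q => by rw [g₂_mul_inv q hm0.ne']; simp [hm0.ne'])
    (isLeast_p₂ (inv_pos.2 hm0) (inv_lt_one_of_one_lt₀ hm))

lemma p₁_reflect {m : ℝ} (hm : 1 < m) : p₁ m = m * p₁ m⁻¹ := (isLeast_p₁_reflect hm).csInf_eq

lemma p₂_reflect {m : ℝ} (hm : 1 < m) : p₂ m = m * p₂ m⁻¹ := (isLeast_p₂_reflect hm).csInf_eq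

lemma p₁_lt_p₂_reflect {m : ℝ} (hm : 1 < m) (h : p₁ m⁻¹ < p₂ m⁻¹) : p₁ m < p₂ m := by
  rw [p₁_reflect hm, p₂_reflect hm]
  exact mul_lt_mul_of_pos_left h (by linarith)

lemma p₂_lt_p₁_reflect {m : ℝ} (hm : 1 < m) (h : p₂ m⁻¹ < p₁ m⁻¹) : p₂ m < p₁ m := by
  rw [p₁_reflect hm, p₂_reflect hm]
  exact mul_lt_mul_of_pos_left h (by linarith)

lemma eventuallyEq_reflect {P : ℝ → ℝ} (hP : ∀ m, 1 < m → P m = m * P m⁻¹)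
    {m : ℝ} (hm : 1 < m) : P =ᶠ[𝓝 m] fun x => x * P x⁻¹ := by
  filter_upwards [lt_mem_nhds hm] with x hx using hP x hx

lemma continuousAt_reflect {P : ℝ → ℝ} (hP : ∀ m, 1 < m → P m = m * P m⁻¹)
    {m : ℝ} (hm : 1 < m) (h : ContinuousAt P m⁻¹) : ContinuousAt P m := by
  refine ContinuousAt.congr ?_ (eventuallyEq_reflect hP hm).symm
  exact continuousAt_id.mul
    (ContinuousAt.comp (f := fun x : ℝ => x⁻¹) (g := P) h (continuousAt_inv₀ (by linarith)))

lemma tendsto_right_reflect {P : ℝ → ℝ} (hP : ∀ m, 1 < m → P m = m * P m⁻¹)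
    (h : Tendsto P (𝓝[<] 1) atTop) : Tendsto P (𝓝[>] 1) atTop := by
  have h1 : Tendsto (fun m : ℝ => m⁻¹) (𝓝[>] 1) (𝓝[<] 1) := by
    refine tendsto_nhdsWithin_iff.2 ⟨?_, ?_⟩
    · have := (continuousAt_inv₀ (one_ne_zero : (1 : ℝ) ≠ 0)).tendsto
      rw [inv_one] at this
      exact this.mono_left nhdsWithin_le_nhds
    · filter_upwards [self_mem_nhdsWithin] with x hx using inv_lt_one_of_one_lt₀ (mem_Ioi.1 hx)
  have h2 := h.comp h1
  refine tendsto_atTop_mono' _ ?_ h2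
  filter_upwards [self_mem_nhdsWithin, h2.eventually (eventually_ge_atTop 0)] with x hx hx2
  rw [hP x hx]
  have : (1 : ℝ) < x := hx
  simp only [Function.comp] at hx2 ⊢
  nlinarith

lemma hasDerivAt_reflect {P : ℝ → ℝ} (hP : ∀ m, 1 < m → P m = m * P m⁻¹)
    {m d : ℝ} (hm : 1 < m) (h : HasDerivAt P d m⁻¹) :
    HasDerivAt P (P m⁻¹ - d * m⁻¹) m := by
  have hm0 : m ≠ 0 := by linarith
  have h1 : HasDerivAt (fun x => P x⁻¹) (d * -(m ^ 2)⁻¹) m :=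
    HasDerivAt.comp (h₂ := P) m h (hasDerivAt_inv hm0)
  have h2 : HasDerivAt (fun x => x * P x⁻¹) (1 * P m⁻¹ + m * (d * -(m ^ 2)⁻¹)) m :=
    (hasDerivAt_id m).mul h1
  refine (h2.congr_of_eventuallyEq (eventuallyEq_reflect hP hm)).congr_deriv ?_
  field_simp
  ring

/-- The difference quotient of x P(1/x) equals P(1/x) minus 1/x times the quotient of `P` at 1/x.
The first term converges by continuity, so the second dominates. -/
lemma hasDerivNegInfAt_reflect {P : ℝ → ℝ} (hP : ∀ m, 1 < m → P m = m * P m⁻¹)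
    {m : ℝ} (hm : 1 < m) (hc : ContinuousAt P m⁻¹)
    (h : HasDerivPosInfAt P m⁻¹) : HasDerivNegInfAt P m := by
  have hm0 : 0 < m := by linarith
  have hinv : Tendsto (fun x : ℝ => x⁻¹) (𝓝[≠] m) (𝓝[≠] m⁻¹) := by
    refine tendsto_nhdsWithin_iff.2
      ⟨(continuousAt_inv₀ hm0.ne').tendsto.mono_left nhdsWithin_le_nhds, ?_⟩
    filter_upwards [self_mem_nhdsWithin] with x hx
    simpa using hx
  have h1 := h.comp hinv
  have h2 : Tendsto (fun x : ℝ => -x⁻¹) (𝓝[≠] m) (𝓝 (-m⁻¹)) :=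
    ((continuousAt_inv₀ hm0.ne').tendsto.neg).mono_left nhdsWithin_le_nhds
  have h3 := h1.atTop_mul_neg (by simpa using hm0) h2
  have h4 : Tendsto (fun x : ℝ => P x⁻¹) (𝓝[≠] m) (𝓝 (P m⁻¹)) :=
    hc.tendsto.comp (hinv.mono_right nhdsWithin_le_nhds)
  refine (h4.add_atBot h3).congr' ?_
  filter_upwards [self_mem_nhdsWithin, nhdsWithin_le_nhds (lt_mem_nhds hm)] with x hx hx1
  have hx0 : x ≠ 0 := by linarith
  have hxm : x - m ≠ 0 := sub_ne_zero.2 hx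
  have hmx : m - x ≠ 0 := sub_ne_zero.2 (Ne.symm hx)
  have e : x⁻¹ - m⁻¹ = (m - x) / (x * m) := by field_simp
  simp only [Function.comp]
  rw [hP x hx1, hP m hm, e]
  field_simp
  ring

lemma tendsto_inv_gt {a : ℝ} (ha : 0 < a) : Tendsto (fun x : ℝ => x⁻¹) (𝓝[>] a⁻¹) (𝓝[<] a) := by
  refine tendsto_nhdsWithin_iff.2 ⟨?_, ?_⟩
  · have := (continuousAt_inv₀ (inv_pos.2 ha).ne').tendsto
    rw [inv_inv] at this
    exact this.mono_left nhdsWithin_le_nhds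
  · filter_upwards [self_mem_nhdsWithin] with x hx using inv_lt_of_inv_lt₀ ha hx

lemma tendsto_inv_lt {a : ℝ} (ha : 0 < a) : Tendsto (fun x : ℝ => x⁻¹) (𝓝[<] a⁻¹) (𝓝[>] a) := by
  refine tendsto_nhdsWithin_iff.2 ⟨?_, ?_⟩
  · have := (continuousAt_inv₀ (inv_pos.2 ha).ne').tendsto
    rw [inv_inv] at this
    exact this.mono_left nhdsWithin_le_nhds
  · filter_upwards [Ioo_mem_nhdsLT (inv_pos.2 ha)] with x hx using (lt_inv_comm₀ hx.1 ha).1 hx.2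

/-- Inversion exchanges the two sides of the point, while the positive factor m preserves the order
of the values. The crossing survives with its direction reversed. -/
lemma graphsCrossAt_reflect {a : ℝ} (ha : 0 < a) (ha1 : a < 1) (h : GraphsCrossAt p₁ p₂ a) :
    GraphsCrossAt p₁ p₂ a⁻¹ := by
  have h1 : 1 < a⁻¹ := one_lt_inv_iff₀.2 ⟨ha, ha1⟩
  have hl : ∀ᶠ x in 𝓝[<] a⁻¹, 1 < x := nhdsWithin_le_nhds (lt_mem_nhds h1)
  have hr : ∀ᶠ x in 𝓝[>] a⁻¹, 1 < x := nhdsWithin_le_nhds (lt_mem_nhds h1)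
  obtain ⟨h0, h⟩ := h
  refine ⟨by rw [p₁_reflect h1, p₂_reflect h1, inv_inv, h0], ?_⟩
  rcases h with ⟨hA, hB⟩ | ⟨hA, hB⟩
  · right
    constructor
    · filter_upwards [hl, (tendsto_inv_lt ha).eventually hB] with x h2 h3
      exact p₂_lt_p₁_reflect h2 h3
    · filter_upwards [hr, (tendsto_inv_gt ha).eventually hA] with x h2 h3
      exact p₁_lt_p₂_reflect h2 h3
  · left
    constructor
    · filter_upwards [hl, (tendsto_inv_lt ha).eventually hB] with x h2 h3
      exact p₁_lt_p₂_reflect h2 h3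
    · filter_upwards [hr, (tendsto_inv_gt ha).eventually hA] with x h2 h3
      exact p₂_lt_p₁_reflect h2 h3

/-! ### Explicit bounds for the crossing points -/

lemma lower_bound_lt_tanRoot_ratio {k : ℕ} (hk : 1 ≤ k) :
    (1 + 2 * k : ℝ) / (3 + 2 * k) - (2 : ℝ) / (15 + 40 * k + 32 * k ^ 2 + 8 * k ^ 3) <
      tanRoot k / tanRoot (k + 1) := by
  have h := lt_tanRoot_ratio hk
  have e : (1 + 2 * k : ℝ) / (3 + 2 * k) - (2 : ℝ) / (15 + 40 * k + 32 * k ^ 2 + 8 * k ^ 3) =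
      (4 * k ^ 2 + 6 * k + 1) / (4 * k ^ 2 + 10 * k + 5) := by
    have : (15 + 40 * k + 32 * k ^ 2 + 8 * k ^ 3 : ℝ) = (3 + 2 * k) * (4 * k ^ 2 + 10 * k + 5) := by
      ring
    rw [this]
    field_simp
    ring
  rw [e, div_lt_div_iff₀ (by positivity) (tanRoot_pos (by omega))]
  linarith

/-- Inverting the bound exactly gives the denominator (1+2k)(4k²+6k+1) = 1 + 8k + 16k² + 8k³. The
stated denominator drops the term 16k². -/
lemma inv_tanRoot_ratio_lt {k : ℕ} (hk : 1 ≤ k) :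
    (tanRoot k / tanRoot (k + 1))⁻¹ <
      (3 + 2 * k : ℝ) / (1 + 2 * k) + (2 : ℝ) / (1 + 8 * k * (1 + k ^ 2)) := by
  have h := lt_tanRoot_ratio hk
  have a := tanRoot_pos hk
  have h1 : (tanRoot k / tanRoot (k + 1))⁻¹ <
      (4 * (k : ℝ) ^ 2 + 10 * k + 5) / (4 * k ^ 2 + 6 * k + 1) := by
    rw [inv_div, div_lt_div_iff₀ a (by positivity)]
    linarith
  have e : (4 * (k : ℝ) ^ 2 + 10 * k + 5) / (4 * k ^ 2 + 6 * k + 1) =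
      (3 + 2 * k : ℝ) / (1 + 2 * k) + 2 / ((1 + 2 * k) * (4 * k ^ 2 + 6 * k + 1)) := by
    field_simp
    ring
  rw [e] at h1
  refine h1.trans_le ?_
  gcongr
  have : (0 : ℝ) ≤ k := by positivity
  nlinarith [sq_nonneg (k : ℝ)]

lemma inv_div_succ (k : ℕ) : ((k : ℝ) / (k + 1))⁻¹ = (k + 1) / k := inv_div _ _

end PlateBall

theorem theorem3 :
    -- the minimal positive roots exist
    (∀ m : ℝ, 0 < m → m ≠ 1 →
      IsLeast {p : ℝ | 0 < p ∧ PlateBall.g₁ p m = 0} (PlateBall.p₁ m) ∧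
      IsLeast {p : ℝ | 0 < p ∧ PlateBall.g₂ p m = 0} (PlateBall.p₂ m)) ∧
    -- a) continuity
    (ContinuousOn PlateBall.p₁ (Ioo 0 1 ∪ Ioi 1) ∧
      ContinuousOn PlateBall.p₂ (Ioo 0 1 ∪ Ioi 1)) ∧
    -- b) the order outside [1/2, 2]
    (∀ m ∈ Ioo (0 : ℝ) (1 / 2) ∪ Ioi 2, PlateBall.p₁ m < PlateBall.p₂ m) ∧
    -- c) the order and the crossings on [1/2, 1)
    (∀ k : ℕ, 1 ≤ k →
      (∀ m ∈ Ioc ((k : ℝ) / (1 + k))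
          ((1 + 2 * k : ℝ) / (3 + 2 * k) - (2 : ℝ) / (15 + 40 * k + 32 * k ^ 2 + 8 * k ^ 3)),
        PlateBall.p₂ m < PlateBall.p₁ m) ∧
      (∀ m ∈ Ico ((1 + 2 * k : ℝ) / (3 + 2 * k)) ((1 + k : ℝ) / (2 + k)),
        PlateBall.p₁ m < PlateBall.p₂ m) ∧
      (∃ m : ℝ, m ∈ Ioo ((1 + 2 * k : ℝ) / (3 + 2 * k)
            - (2 : ℝ) / (15 + 40 * k + 32 * k ^ 2 + 8 * k ^ 3))
          ((1 + 2 * k : ℝ) / (3 + 2 * k)) ∧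
        PlateBall.GraphsCrossAt PlateBall.p₁ PlateBall.p₂ m) ∧
      PlateBall.GraphsCrossAt PlateBall.p₁ PlateBall.p₂ ((k : ℝ) / (k + 1)) ∧
      PlateBall.p₁ ((k : ℝ) / (k + 1)) = Real.pi * k ∧
      PlateBall.p₂ ((k : ℝ) / (k + 1)) = Real.pi * k ∧
      Real.pi * ((k : ℝ) / (k + 1)) / (1 - (k : ℝ) / (k + 1)) = Real.pi * k) ∧
    -- c) the order and the crossings on (1, 2]
    (∀ k : ℕ, 1 ≤ k →
      (∀ m ∈ Ioc ((k + 2 : ℝ) / (k + 1)) ((3 + 2 * k : ℝ) / (1 + 2 * k)),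
        PlateBall.p₁ m < PlateBall.p₂ m) ∧
      (∀ m ∈ Ico ((3 + 2 * k : ℝ) / (1 + 2 * k) + (2 : ℝ) / (1 + 8 * k * (1 + k ^ 2)))
          ((k + 1 : ℝ) / k),
        PlateBall.p₂ m < PlateBall.p₁ m) ∧
      (∃ m : ℝ, m ∈ Ioo ((3 + 2 * k : ℝ) / (1 + 2 * k))
          ((3 + 2 * k : ℝ) / (1 + 2 * k) + (2 : ℝ) / (1 + 8 * k * (1 + k ^ 2))) ∧
        PlateBall.GraphsCrossAt PlateBall.p₁ PlateBall.p₂ m) ∧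
      PlateBall.GraphsCrossAt PlateBall.p₁ PlateBall.p₂ ((k + 1 : ℝ) / k) ∧
      PlateBall.p₁ ((k + 1 : ℝ) / k) = Real.pi * (k + 1) ∧
      PlateBall.p₂ ((k + 1 : ℝ) / k) = Real.pi * (k + 1)) ∧
    -- d) both functions tend to infinity at 1
    (Tendsto PlateBall.p₁ (𝓝[≠] 1) atTop ∧ Tendsto PlateBall.p₂ (𝓝[≠] 1) atTop) ∧
    -- e) the derivatives at the crossings k/(k+1) and (k+1)/k
    (∀ k : ℕ, 1 ≤ k →
      (PlateBall.HasDerivPosInfAt PlateBall.p₁ ((k : ℝ) / (k + 1)) ∧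
        ∃ d : ℝ, 0 < d ∧ HasDerivAt PlateBall.p₂ d ((k : ℝ) / (k + 1))) ∧
      (PlateBall.HasDerivNegInfAt PlateBall.p₁ ((k + 1 : ℝ) / k) ∧
        ∃ d : ℝ, d < 0 ∧ HasDerivAt PlateBall.p₂ d ((k + 1 : ℝ) / k))) := by
  have hR1 : ∀ m, 1 < m → PlateBall.p₁ m = m * PlateBall.p₁ m⁻¹ := fun m => PlateBall.p₁_reflect
  have hR2 : ∀ m, 1 < m → PlateBall.p₂ m = m * PlateBall.p₂ m⁻¹ := fun m => PlateBall.p₂_reflect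
  have hinv0 : ∀ m : ℝ, 1 < m → 0 < m⁻¹ := fun m hm => inv_pos.2 (by linarith)
  have hinv1 : ∀ m : ℝ, 1 < m → m⁻¹ < 1 := fun m => inv_lt_one_of_one_lt₀
  refine ⟨fun m hm hm1 => ?_, ⟨fun m hm => ?_, fun m hm => ?_⟩, fun m hm => ?_, fun k hk => ?_,
    fun k hk => ?_, ⟨?_, ?_⟩, fun k hk => ?_⟩
  · rcases lt_or_gt_of_ne hm1 with h | h
    · exact ⟨PlateBall.isLeast_p₁ hm h, PlateBall.isLeast_p₂ hm h⟩
    · rw [PlateBall.p₁_reflect h, PlateBall.p₂_reflect h]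
      exact ⟨PlateBall.isLeast_p₁_reflect h, PlateBall.isLeast_p₂_reflect h⟩
  · refine ContinuousAt.continuousWithinAt ?_
    rcases hm with hm | hm
    · exact PlateBall.continuousAt_p₁_of_lt hm.1 hm.2
    · exact PlateBall.continuousAt_reflect hR1 hm
        (PlateBall.continuousAt_p₁_of_lt (hinv0 m hm) (hinv1 m hm))
  · refine ContinuousAt.continuousWithinAt ?_
    rcases hm with hm | hm
    · exact PlateBall.continuousAt_p₂_of_lt hm.1 hm.2
    · exact PlateBall.continuousAt_reflect hR2 hm
        (PlateBall.continuousAt_p₂_of_lt (hinv0 m hm) (hinv1 m hm))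
  · have h : ∀ x : ℝ, 0 < x → x < 1 / 2 → PlateBall.p₁ x < PlateBall.p₂ x := fun x h0 h1 =>
      PlateBall.p₁_lt_p₂ (k := 0) (by simpa [PlateBall.tanRoot_zero] using h0) (by simpa using h1)
    rcases hm with hm | hm
    · exact h m hm.1 hm.2
    · have hm : (2 : ℝ) < m := hm
      have hm1 : 1 < m := by linarith
      refine PlateBall.p₁_lt_p₂_reflect hm1 (h _ (hinv0 m hm1) ?_)
      rw [one_div]
      exact inv_strictAnti₀ (by norm_num) hm
  · refine ⟨fun m hm => ?_, fun m hm => ?_,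
      ⟨_, ⟨PlateBall.lower_bound_lt_tanRoot_ratio hk, ?_⟩,
        PlateBall.graphsCrossAt_tanRoot_ratio hk⟩,
      PlateBall.graphsCrossAt_div_succ hk, PlateBall.p₁_div_succ hk, PlateBall.p₂_div_succ hk, ?_⟩
    · refine PlateBall.p₂_lt_p₁ hk ?_ (hm.2.trans_lt (PlateBall.lower_bound_lt_tanRoot_ratio hk))
      rw [add_comm (k : ℝ)]
      exact hm.1
    · refine PlateBall.p₁_lt_p₂ (k := k) ?_ ?_
      · refine (PlateBall.tanRoot_ratio_lt_div k).trans_le ?_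
        rw [add_comm (2 * (k : ℝ)), add_comm (2 * (k : ℝ))]
        exact hm.1
      · rw [add_comm (k : ℝ), add_comm (k : ℝ)]
        exact hm.2
    · rw [add_comm (1 : ℝ), add_comm (3 : ℝ)]
      exact PlateBall.tanRoot_ratio_lt_div k
    · have : (k : ℝ) + 1 ≠ 0 := by positivity
      field_simp
      ring
  · have hk0 : (0 : ℝ) < k := by exact_mod_cast hk
    have hmid : 1 < (3 + 2 * k : ℝ) / (1 + 2 * k) := by
      rw [one_lt_div (by positivity)]; linarith
    have hlow : 1 < ((k : ℝ) + 2) / (k + 1) := by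
      rw [one_lt_div (by positivity)]; linarith
    have hend : 1 < ((k : ℝ) + 1) / k := by
      rw [one_lt_div (by positivity)]; linarith
    have hrat : 0 < PlateBall.tanRoot k / PlateBall.tanRoot (k + 1) :=
      div_pos (PlateBall.tanRoot_pos hk) (PlateBall.tanRoot_pos (by omega))
    have hrat1 : PlateBall.tanRoot k / PlateBall.tanRoot (k + 1) < 1 := by
      rw [div_lt_one (PlateBall.tanRoot_pos (by omega))]
      exact PlateBall.strictMono_tanRoot (by omega)
    have hmidinv : (3 + 2 * k : ℝ) / (1 + 2 * k) <
        (PlateBall.tanRoot k / PlateBall.tanRoot (k + 1))⁻¹ := by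
      rw [lt_inv_comm₀ (by linarith) hrat, inv_div, add_comm (1 : ℝ), add_comm (3 : ℝ)]
      exact PlateBall.tanRoot_ratio_lt_div k
    refine ⟨fun m hm => ?_, fun m hm => ?_,
      ⟨_, ⟨hmidinv, PlateBall.inv_tanRoot_ratio_lt hk⟩,
        PlateBall.graphsCrossAt_reflect hrat hrat1 (PlateBall.graphsCrossAt_tanRoot_ratio hk)⟩,
      ?_, ?_, ?_⟩
    · have hm1 : 1 < m := hlow.trans hm.1
      have hm0 : 0 < m := by linarith
      refine PlateBall.p₁_lt_p₂_reflect hm1 (PlateBall.p₁_lt_p₂ (k := k) ?_ ?_)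
      · exact (lt_inv_comm₀ hm0 hrat).1 (hm.2.trans_lt hmidinv)
      · rw [inv_lt_comm₀ hm0 (by positivity), inv_div]
        exact hm.1
    · have h1 := (PlateBall.inv_tanRoot_ratio_lt hk).trans_le hm.1
      have hm1 : 1 < m := (one_lt_inv_iff₀.2 ⟨hrat, hrat1⟩).trans h1
      have hm0 : 0 < m := by linarith
      refine PlateBall.p₂_lt_p₁_reflect hm1 (PlateBall.p₂_lt_p₁ hk ?_ ?_)
      · rw [lt_inv_comm₀ (by positivity) hm0, inv_div]
        exact hm.2
      · exact (inv_lt_comm₀ hrat hm0).1 h1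
    · rw [← PlateBall.inv_div_succ]
      refine PlateBall.graphsCrossAt_reflect (by positivity) ?_ (PlateBall.graphsCrossAt_div_succ hk)
      rw [div_lt_one (by positivity)]; linarith
    · rw [hR1 _ hend, inv_div, PlateBall.p₁_div_succ hk]
      field_simp
    · rw [hR2 _ hend, inv_div, PlateBall.p₂_div_succ hk]
      field_simp
  · rw [← nhdsLT_sup_nhdsGT]
    exact PlateBall.tendsto_p₁_left.sup
      (PlateBall.tendsto_right_reflect hR1 PlateBall.tendsto_p₁_left)
  · rw [← nhdsLT_sup_nhdsGT]
    exact PlateBall.tendsto_p₂_left.sup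
      (PlateBall.tendsto_right_reflect hR2 PlateBall.tendsto_p₂_left)
  · have hk0 : (0 : ℝ) < k := by exact_mod_cast hk
    have hend : 1 < ((k : ℝ) + 1) / k := by
      rw [one_lt_div (by positivity)]; linarith
    have hn0 : 0 < (k : ℝ) / (k + 1) := by positivity
    have hn1 : (k : ℝ) / (k + 1) < 1 := by rw [div_lt_one (by positivity)]; linarith
    have hsq : 0 < 1 - ((k : ℝ) / (k + 1)) ^ 2 := by nlinarith
    have hp : 0 < Real.pi * k := mul_pos Real.pi_pos hk0
    have e : (((k : ℝ) + 1) / k)⁻¹ = k / (k + 1) := inv_div _ _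
    refine ⟨⟨PlateBall.hasDerivPosInfAt_p₁_div_succ hk, _, ?_,
        PlateBall.hasDerivAt_p₂_div_succ hk⟩,
      PlateBall.hasDerivNegInfAt_reflect hR1 hend ?_ ?_, _, ?_,
        PlateBall.hasDerivAt_reflect hR2 hend (by
          rw [e]; exact PlateBall.hasDerivAt_p₂_div_succ hk)⟩
    · exact div_pos hp (mul_pos hn0 hsq)
    · rw [e]; exact PlateBall.continuousAt_p₁_of_lt hn0 hn1
    · rw [e]; exact PlateBall.hasDerivPosInfAt_p₁_div_succ hk
    -- With n = k/(k+1) the reflected slope is πk - πk/(1 - n²), which is negative because 0 < 1 -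
    -- n² < 1.
    · rw [e, PlateBall.p₂_div_succ hk]
      generalize (k : ℝ) / (k + 1) = n at hn0 hn1 hsq ⊢
      have e1 : Real.pi * k / (n * (1 - n ^ 2)) * n = Real.pi * k / (1 - n ^ 2) := by
        field_simp
      rw [e1, sub_neg, lt_div_iff₀ hsq]
      nlinarith [mul_pos hp (pow_pos hn0 2)]
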